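/- Work in a big model $\mathcal M$ of a complete consistent first-order theory $T$, possibly many-sorted (for instance $T^{\mathrm{eq}}$): fix a cardinal $\bar\kappa=\beth_{\bar\kappa}$ greater than the cardinality of the language such that $\mathcal M$ is $\bar\kappa$-saturated and strongly $\bar\kappa$-homogeneous. "Small" means of cardinality $<\bar\kappa$. All sets of parameters are small subsets of $\mathcal M$, tuples are small and possibly infinite, $\operatorname{acl}$ is algebraic closure, $AB$ means $A\cup B$, a tuple is also used for the set of its entries, and $\bar a\equiv_B\bar a'$ (or $A\equiv_B A'$) means that some automorphism of $\mathcal M$ fixes $B$ pointwise and maps the first tuple (set) to the second. An *independence relation* is a ternary relation $A\perp_C B$ between small sets that satisfies: - (invariance) it is preserved by automorphisms of $\mathcal M$; - (monotonicity) if $A\perp_C B$, $A'\subseteq A$ and $B'\subseteq B$, then $A'\perp_C B'$; - (base monotonicity) if $D\subseteq C\subseteq B$ and $A\perp_D B$, then $A\perp_C B$; - (transitivity) if $D\subseteq C\subseteq B$, $B\perp_C A$ and $C\perp_D A$, then $B\perp_D A$; - (normality) if $A\perp_C B$, then $AC\perp_C B$; - (extension) if $A\perp_C B$ and $\hat B\supseteq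 B$, then $A'\perp_C\hat B$ for some $A'\equiv_{BC}A$; - (finite character) if $A_0\perp_C B$ for all finite $A_0\subseteq A$, then $A\perp_C B$; - (local character) for every $A$ there is a small cardinal $\kappa(A)$ such that for every $B$ there is $C\subseteq B$ with $|C|<\kappa(A)$ and $A\perp_C B$. It is *strict* if, for every element $a$ and every $B$, $a\perp_B a$ implies $a\in\operatorname{acl}B$. It is *canonical* if it is strict and has the intersection property: if $C_1,C_2\subseteq B$, $A\perp_{C_1}B$ and $A\perp_{C_2}B$, then $A\perp_{\operatorname{acl}C_1\cap\operatorname{acl}C_2}B$. For a tuple $\bar a$ and $B=\operatorname{acl}B$, the *weak canonical base* of $\operatorname{tp}(\bar a/B)$ is the smallest algebraically closed set $C\subseteq B$ such that $\bar a\perp_C B$, if there is one: that is, $C$ has these properties, and $C\subseteq D$ for every $D=\operatorname{acl}D\subseteq B$ with $\bar a\perp_D B$. The relation *has weak canonical bases* if $\operatorname{tp}(\bar a/B)$ has a weak canonical base for all $\bar a$ and all $B=\operatorname{acl}B$. A *Morley sequence* for $\operatorname{tp}(\bar a/B)$ is a $B$-indiscernible sequence $(\bar a_i)_{i<\omega}$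 of realisations of $\operatorname{tp}(\bar a/B)$ such that $\bar a_{<n}\perp_B\bar a_n$ for all $n<\omega$. The *algebraic kernel* $\operatorname{aker}(\bar a_i)_{i<\omega}$ of an indiscernible sequence is the set of all $d\in\operatorname{acl}\big(\bigcup_{i<\omega}\bar a_i\big)$ such that $(\bar a_i)_{i<\omega}$ is indiscernible over $d$. **Theorem.** (1) A strict independence relation has weak canonical bases if and only if it is canonical. (2) If $\perp$ is a canonical independence relation, $\bar a$ is a tuple and $B=\operatorname{acl}B$, then there is a Morley sequence for $\operatorname{tp}(\bar a/B)$, and for every Morley sequence $(\bar a_i)_{i<\omega}$ for $\operatorname{tp}(\bar a/B)$ the weak canonical base of $\operatorname{tp}(\bar a/B)$ is $\operatorname{aker}(\bar a_i)_{i<\omega}$. -/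

import Mathlib

open Set Cardinal

universe u

namespace ManySorted

/-- A many-sorted first-order language: a set of sorts, function symbols with prescribed
argument sorts and value sort, and relation symbols with prescribed argument sorts.
The one-sorted languages are those with exactly one sort. -/
structure Language where
  Srt : Type u
  Fn : (n : ℕ) → (Fin n → Srt) → Srt → Type u
  Rl : (n : ℕ) → (Fin n → Srt) → Type u

/-- The number of sorts and of symbols of a language. -/
noncomputable def Language.card (L : Language.{u}) : Cardinal.{u} :=
  #L.Srt + #(Σ (n : ℕ) (Γ : Fin n → L.Srt) (s : L.Srt), L.Fn n Γ s) +
    #(Σ (n : ℕ) (Γ : Fin n → L.Srt), L.Rl n Γ)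

/-- `Term L Γ s` is the type of `L`-terms of sort `s` in the variables `0, …, n - 1`,
where variable `i` has sort `Γ i`. -/
inductive Term (L : Language.{u}) {n : ℕ} (Γ : Fin n → L.Srt) : L.Srt → Type u
  | var (i : Fin n) : Term L Γ (Γ i)
  | app {k : ℕ} {Δ : Fin k → L.Srt} {s : L.Srt} (f : L.Fn k Δ s)
      (ts : ∀ i, Term L Γ (Δ i)) : Term L Γ s

/-- `Formula L n Γ` is the type of first-order `L`-formulas in the free variables
`0, …, n - 1`, where variable `i` has sort `Γ i`. In `all s φ` the variable `0` of `φ`, of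
sort `s`, is bound. -/
inductive Formula (L : Language.{u}) : (n : ℕ) → (Fin n → L.Srt) → Type u
  | equal {n : ℕ} {Γ : Fin n → L.Srt} {s : L.Srt} (t₁ t₂ : Term L Γ s) : Formula L n Γ
  | rel {n : ℕ} {Γ : Fin n → L.Srt} {k : ℕ} {Δ : Fin k → L.Srt} (R : L.Rl k Δ)
      (ts : ∀ i, Term L Γ (Δ i)) : Formula L n Γ
  | falsum {n : ℕ} {Γ : Fin n → L.Srt} : Formula L n Γ
  | imp {n : ℕ} {Γ : Fin n → L.Srt} (φ ψ : Formula L n Γ) : Formula L n Γ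
  | all {n : ℕ} {Γ : Fin n → L.Srt} (s : L.Srt) (φ : Formula L (n + 1) (Fin.cons s Γ)) :
      Formula L n Γ

/-- An `L`-structure whose universe of sort `s` is `M s`. -/
class Struct (L : Language.{u}) (M : L.Srt → Type u) where
  fn : ∀ {n : ℕ} {Γ : Fin n → L.Srt} {s : L.Srt}, L.Fn n Γ s → (∀ i, M (Γ i)) → M s
  rl : ∀ {n : ℕ} {Γ : Fin n → L.Srt}, L.Rl n Γ → (∀ i, M (Γ i)) → Prop

/-- The tuple `m, v 0, v 1, …` obtained by adding a new entry at the front. -/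
def consTuple {S : Type u} {M : S → Type u} {n : ℕ} {Γ : Fin n → S} {s : S} (m : M s)
    (v : ∀ i, M (Γ i)) : ∀ i : Fin (n + 1), M ((Fin.cons s Γ : Fin (n + 1) → S) i) :=
  fun i => Fin.cases (motive := fun i => M ((Fin.cons s Γ : Fin (n + 1) → S) i)) m v i

section Semantics

variable {L : Language.{u}} {M : L.Srt → Type u} [Struct L M]

/-- The value of a term under an assignment. -/
def Term.eval {n : ℕ} {Γ : Fin n → L.Srt} (v : ∀ i, M (Γ i)) :
    {s : L.Srt} → Term L Γ s → M s
  | _, .var i => v i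
  | _, .app f ts => Struct.fn f (fun i => (ts i).eval v)

/-- Truth of a formula under an assignment. -/
def Formula.Realize : {n : ℕ} → {Γ : Fin n → L.Srt} → Formula L n Γ →
    (∀ i, M (Γ i)) → Prop
  | _, _, .equal t₁ t₂, v => t₁.eval v = t₂.eval v
  | _, _, .rel R ts, v => Struct.rl R (fun i => (ts i).eval v)
  | _, _, .falsum, _ => False
  | _, _, .imp φ ψ, v => φ.Realize v → ψ.Realize v
  | _, _, .all s φ, v => ∀ m : M s, φ.Realize (consTuple m v)

end Semantics

/-- The elements of a many-sorted structure, of all sorts together. -/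
abbrev Elem {L : Language.{u}} (M : L.Srt → Type u) : Type u := Σ s, M s

/-- Automorphisms of a many-sorted structure. -/
structure Aut (L : Language.{u}) (M : L.Srt → Type u) [Struct L M] where
  toEquiv : ∀ s, M s ≃ M s
  map_fn : ∀ {n : ℕ} {Γ : Fin n → L.Srt} {s : L.Srt} (f : L.Fn n Γ s) (v : ∀ i, M (Γ i)),
    toEquiv s (Struct.fn f v) = Struct.fn f (fun i => toEquiv (Γ i) (v i))
  map_rl : ∀ {n : ℕ} {Γ : Fin n → L.Srt} (R : L.Rl n Γ) (v : ∀ i, M (Γ i)),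
    Struct.rl R (fun i => toEquiv (Γ i) (v i)) ↔ Struct.rl R v

/-- The action of an automorphism on elements. -/
def Aut.act {L : Language.{u}} {M : L.Srt → Type u} [Struct L M] (g : Aut L M)
    (x : Elem M) : Elem M :=
  ⟨x.1, g.toEquiv x.1 x.2⟩

/-- The automorphism fixes every element of `B`. -/
def Aut.Fixes {L : Language.{u}} {M : L.Srt → Type u} [Struct L M] (g : Aut L M)
    (B : Set (Elem M)) : Prop :=
  ∀ b ∈ B, g.act b = b

section Model

variable (L : Language.{u}) {M : L.Srt → Type u} [Struct L M]

/-- `X`, a set of elements of sort `s`, is defined by a formula with parameters from `A`. -/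
def DefinableOver (A : Set (Elem M)) (s : L.Srt) (X : Set (M s)) : Prop :=
  ∃ (n : ℕ) (Γ : Fin n → L.Srt) (φ : Formula L (n + 1) (Fin.cons s Γ)) (v : ∀ i, M (Γ i)),
    (∀ i, (⟨Γ i, v i⟩ : Elem M) ∈ A) ∧ X = {m | φ.Realize (consTuple m v)}

/-- Algebraic closure: the union of all finite sets that are definable over `A`. -/
def acl (A : Set (Elem M)) : Set (Elem M) :=
  {d | ∃ X : Set (M d.1), DefinableOver L A d.1 X ∧ X.Finite ∧ d.2 ∈ X}

/-- Two (possibly infinite) tuples with the same sorts have the same type over the empty set. -/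
def SameType {ι : Type u} {σ : ι → L.Srt} (a b : ∀ i, M (σ i)) : Prop :=
  ∀ (n : ℕ) (f : Fin n → ι) (φ : Formula L n (fun k => σ (f k))),
    φ.Realize (fun k => a (f k)) ↔ φ.Realize (fun k => b (f k))

variable (M)

/-- `M` is a big model (of its complete theory), where "small" means "of cardinality less
than `κ`": `κ` is a fixed point of the beth function (for instance a strongly inaccessible
cardinal) greater than the cardinality of the language, and `M` is `κ`-saturated and
strongly `κ`-homogeneous. Saturation is expressed with definable sets in place of formulas:
a finitely satisfiable set of formulas in one variable of sort `s` over a small set is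
realised. -/
structure IsBigModel (κ : Cardinal.{u}) : Prop where
  card_lt : L.card < κ
  beth_eq : beth κ.ord = κ
  saturated : ∀ (A : Set (Elem M)) (s : L.Srt) (p : Set (Set (M s))), #A < κ →
    (∀ X ∈ p, DefinableOver L A s X) →
    (∀ F : Set (Set (M s)), F ⊆ p → F.Finite → (⋂₀ F).Nonempty) → (⋂₀ p).Nonempty
  homogeneous : ∀ (ι : Type u) (σ : ι → L.Srt) (a b : ∀ i, M (σ i)), #ι < κ →
    SameType L a b → ∃ g : Aut L M, ∀ i, g.toEquiv (σ i) (a i) = b i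

variable {M}

/-- `a ≡_B b` for tuples: some automorphism fixes `B` pointwise and maps `a` to `b`. -/
def EquivOver {ι : Type u} (B : Set (Elem M)) (a b : ι → Elem M) : Prop :=
  ∃ g : Aut L M, g.Fixes B ∧ ∀ x, g.act (a x) = b x

/-- The sequence `(a i)` of tuples is indiscernible over `B`: any two increasing finite
subsequences of the same length have the same type over `B`. -/
def IndiscernibleOver {I : Type} [LinearOrder I] {ι : Type u} (B : Set (Elem M))
    (a : I → ι → Elem M) : Prop :=
  ∀ (n : ℕ) (i j : Fin n → I), StrictMono i → StrictMono j →
    ∃ g : Aut L M, g.Fixes B ∧ ∀ k x, g.act (a (i k) x) = a (j k) x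

/-- The algebraic kernel of a sequence `(a i)` of indiscernible tuples. -/
def aker {I : Type} [LinearOrder I] {ι : Type u} (a : I → ι → Elem M) : Set (Elem M) :=
  {d | d ∈ acl L (⋃ i, range (a i)) ∧ IndiscernibleOver L {d} a}

/-! Ternary relations between small sets: `ind A C B` is read "`A` is independent from `B`
over `C`". Values of `ind` at sets that are not small play no role. -/

/-- Independence relations (for the big model `M`). -/
structure IsIndependenceRelation (κ : Cardinal.{u})
    (ind : Set (Elem M) → Set (Elem M) → Set (Elem M) → Prop) : Prop where
  invariance : ∀ A B C : Set (Elem M), #A < κ → #B < κ → #C < κ → ∀ g : Aut L M,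
    ind A C B → ind (g.act '' A) (g.act '' C) (g.act '' B)
  monotonicity : ∀ A B C A' B' : Set (Elem M), #A < κ → #B < κ → #C < κ →
    A' ⊆ A → B' ⊆ B → ind A C B → ind A' C B'
  base_monotonicity : ∀ A B C D : Set (Elem M), #A < κ → #B < κ →
    D ⊆ C → C ⊆ B → ind A D B → ind A C B
  transitivity : ∀ A B C D : Set (Elem M), #A < κ → #B < κ →
    D ⊆ C → C ⊆ B → ind B C A → ind C D A → ind B D A
  normality : ∀ A B C : Set (Elem M), #A < κ → #B < κ → #C < κ →
    ind A C B → ind (A ∪ C) C B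
  extension : ∀ A B C B' : Set (Elem M), #A < κ → #B' < κ → #C < κ →
    ind A C B → B ⊆ B' → ∃ g : Aut L M, g.Fixes (B ∪ C) ∧ ind (g.act '' A) C B'
  finite_character : ∀ A B C : Set (Elem M), #A < κ → #B < κ → #C < κ →
    (∀ A₀ : Set (Elem M), A₀ ⊆ A → A₀.Finite → ind A₀ C B) → ind A C B
  local_character : ∀ A : Set (Elem M), #A < κ → ∃ μ < κ, ∀ B : Set (Elem M), #B < κ →
    ∃ C : Set (Elem M), C ⊆ B ∧ #C < μ ∧ ind A C B

/-- Strict independence relations: those that satisfy anti-reflexivity. -/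
structure IsStrictIndependenceRelation (κ : Cardinal.{u})
    (ind : Set (Elem M) → Set (Elem M) → Set (Elem M) → Prop) : Prop
    extends IsIndependenceRelation L κ ind where
  anti_reflexivity : ∀ (a : Elem M) (B : Set (Elem M)), #B < κ → ind {a} B {a} → a ∈ acl L B

/-- Canonical independence relations: the strict ones with the intersection property. -/
structure IsCanonicalIndependenceRelation (κ : Cardinal.{u})
    (ind : Set (Elem M) → Set (Elem M) → Set (Elem M) → Prop) : Prop
    extends IsStrictIndependenceRelation L κ ind where
  intersection : ∀ A B C₁ C₂ : Set (Elem M), #A < κ → #B < κ → C₁ ⊆ B → C₂ ⊆ B →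
    ind A C₁ B → ind A C₂ B → ind A (acl L C₁ ∩ acl L C₂) B

/-- `C` is the weak canonical base of `tp(a/B)` with respect to `ind`, where `B` is
algebraically closed: the smallest algebraically closed subset of `B` over which `a` is
independent from `B`. -/
def IsWeakCanonicalBase (ind : Set (Elem M) → Set (Elem M) → Set (Elem M) → Prop)
    {ι : Type u} (a : ι → Elem M) (B C : Set (Elem M)) : Prop :=
  IsLeast {D : Set (Elem M) | acl L D = D ∧ D ⊆ B ∧ ind (range a) D B} C

/-- `ind` has weak canonical bases: every type of a small tuple over a small algebraically
closed set has one. -/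
def HasWeakCanonicalBases (κ : Cardinal.{u})
    (ind : Set (Elem M) → Set (Elem M) → Set (Elem M) → Prop) : Prop :=
  ∀ (ι : Type u) (a : ι → Elem M) (B : Set (Elem M)), #ι < κ → #B < κ → acl L B = B →
    ∃ C : Set (Elem M), IsWeakCanonicalBase L ind a B C

/-- `(a i)` is an `ind`-Morley sequence in `tp(a₀/B)` over `C`. -/
structure IsMorleySequenceIn (ind : Set (Elem M) → Set (Elem M) → Set (Elem M) → Prop)
    {ι : Type u} (a₀ : ι → Elem M) (B C : Set (Elem M)) (a : ℕ → ι → Elem M) : Prop where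
  subset : C ⊆ B
  indiscernible : IndiscernibleOver L B a
  realises : ∀ i, EquivOver L B a₀ (a i)
  independent : ∀ n : ℕ, ind (⋃ i ∈ Iio n, range (a i)) C (range (a n))

/-- `(a i)` is an `ind`-Morley sequence for `tp(a₀/B)`. -/
def IsMorleySequenceFor (ind : Set (Elem M) → Set (Elem M) → Set (Elem M) → Prop)
    {ι : Type u} (a₀ : ι → Elem M) (B : Set (Elem M)) (a : ℕ → ι → Elem M) : Prop :=
  IsMorleySequenceIn L ind a₀ B B a

end Model

end ManySorted

/-! A Morley sequence `(a i)` for `tp(a₀/B)` confines the weak canonical base from both sides.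

On one side, suppose that `a₀ ⊥_D B` with `D ⊆ B` algebraically closed. Then each `a n` is
independent over `D` from `B` and all earlier terms, so disjoint consecutive blocks of the sequence
are independent over `D`. An element `d` of the algebraic kernel is algebraic over an initial block
and, by indiscernibility over `d`, over the next block as well; hence `d ⊥_D d`, and strictness puts
`d` into `D` (`aker_subset`).

On the other side, stretch the sequence beyond the local character of `B`. Then `B` is independent
from the whole sequence over an initial segment `V`, and by symmetry the next term is independent
from `B ∪ V` over `V`; as the sequence is Morley, it is so over `B` too. The intersection property
makes `B ∩ acl V` a base, and this set lies in the kernel (`exists_subset_aker`). So the kernel is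
the least base. Conversely, if weak canonical bases exist, the base of `tp(A/acl B)` lies in both
`acl C₁` and `acl C₂`, and base monotonicity gives the intersection property.

Two facts have to be derived from the axioms: symmetry (`symm`) and the existence of Morley
sequences. Both start from a long sequence built by extension. The Erdős–Rado theorem, available
because `κ` is a fixed point of the beth function, and compactness turn it into an indiscernible
sequence of any small order type. -/

/-! ### The Erdős–Rado theorem -/

namespace ErdosRado

section Tree

variable {I Λ : Type u} [LinearOrder I] [WellFoundedLT I] (f : Finset I → Λ)

/-- The predecessors of `x` in the Erdős–Rado tree of the colouring `f` of the finite subsets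
of a well-order. -/
def treePred : I → Set I :=
  (wellFounded_lt (α := I)).fix fun x rec =>
    {y | ∃ h : y < x, ∀ s : Finset I, (s : Set I) ⊆ rec y h → f (insert y s) = f (insert x s)}

variable {f}

theorem mem_treePred {x y : I} : y ∈ treePred f x ↔
    y < x ∧ ∀ s : Finset I, (s : Set I) ⊆ treePred f y → f (insert y s) = f (insert x s) := by
  have := (wellFounded_lt (α := I)).fix_eq (fun x rec =>
    {y | ∃ h : y < x, ∀ s : Finset I, (s : Set I) ⊆ rec y h → f (insert y s) = f (insert x s)}) x
  change treePred f x = {y | ∃ h : y < x, ∀ s : Finset I, (s : Set I) ⊆ treePred f y →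
    f (insert y s) = f (insert x s)} at this
  rw [this]
  simp

theorem treePred_subset (y : I) : ∀ z ∈ treePred f y, treePred f z ⊆ treePred f y := by
  induction y using WellFoundedLT.induction with
  | _ y ih =>
    intro z hz w hw
    obtain ⟨hzy, hz'⟩ := mem_treePred.1 hz
    obtain ⟨hwz, hw'⟩ := mem_treePred.1 hw
    exact mem_treePred.2 ⟨hwz.trans hzy, fun s hs =>
      (hw' s hs).trans (hz' s (hs.trans (ih z hzy w hw)))⟩

/-- With `treePred_subset`, this makes the predecessors of a node a chain in the tree, in the order
of `I`. -/
theorem mem_treePred_of_lt {x y' : I} (hy' : y' ∈ treePred f x) (y : I) :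
    y ∈ treePred f x → y < y' → y ∈ treePred f y' := by
  induction y using WellFoundedLT.induction with
  | _ y ih =>
    intro hy hlt
    have hsub : treePred f y ⊆ treePred f y' := fun z hz =>
      have hzy := (mem_treePred.1 hz).1
      ih z hzy (treePred_subset x y hy hz) (hzy.trans hlt)
    exact mem_treePred.2 ⟨hlt, fun s hs => ((mem_treePred.1 hy).2 s hs).trans
      ((mem_treePred.1 hy').2 s (hs.trans hsub)).symm⟩

/-! ### Levels and colour codes: a tree with short branches is small. -/

section Level

variable {W : Type u} [LinearOrder W] [WellFoundedLT W]

variable (f) in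
/-- The height of `x` in the Erdős–Rado tree, as an element of a large enough well-order. -/
noncomputable def treeLevel (h : ∀ x, #(treePred f x) < #W) : I → W :=
  (wellFounded_lt (α := I)).fix fun x rec =>
    (wellFounded_lt (α := W)).min {w | ∀ y : treePred f x,
      w ≠ rec y (mem_treePred.1 y.2).1} (by
        by_contra hne
        rw [Set.not_nonempty_iff_eq_empty] at hne
        refine (h x).not_ge (mk_le_of_surjective
          (f := fun y : treePred f x => rec y (mem_treePred.1 y.2).1) fun w => ?_)
        have : w ∉ {w | ∀ y : treePred f x, w ≠ rec y (mem_treePred.1 y.2).1} := by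
          rw [hne]; exact Set.notMem_empty w
        simp only [Set.mem_ofPred_eq, not_forall, not_not] at this
        obtain ⟨y, hy⟩ := this
        exact ⟨y, hy.symm⟩)

variable {h : ∀ x, #(treePred f x) < #W}

theorem treeLevel_spec (x : I) : (∀ y ∈ treePred f x, treeLevel f h x ≠ treeLevel f h y) ∧
    ∀ w, (∀ y ∈ treePred f x, w ≠ treeLevel f h y) → treeLevel f h x ≤ w := by
  have hx : treeLevel f h x = (wellFounded_lt (α := W)).min {w | ∀ y : treePred f x,
      w ≠ treeLevel f h y} _ := (wellFounded_lt (α := I)).fix_eq _ x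
  rw [hx]
  constructor
  · intro y hy
    exact WellFounded.min_mem (wellFounded_lt (α := W)) {w | ∀ y : treePred f x,
      w ≠ treeLevel f h y} _ ⟨y, hy⟩
  · intro w hw
    exact not_lt.1 (WellFounded.not_lt_min (wellFounded_lt (α := W)) {w | ∀ y : treePred f x,
      w ≠ treeLevel f h y} (fun y => hw y y.2))

theorem treeLevel_lt {x y : I} (hy : y ∈ treePred f x) : treeLevel f h y < treeLevel f h x :=
  lt_of_le_of_ne ((treeLevel_spec y).2 _ fun z hz =>
    (treeLevel_spec x).1 z (treePred_subset x y hy hz)) ((treeLevel_spec x).1 y hy).symm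

theorem exists_treeLevel_eq {x : I} {w : W} (hw : w < treeLevel f h x) :
    ∃ y ∈ treePred f x, treeLevel f h y = w := by
  by_contra hcon
  push Not at hcon
  exact hw.not_ge ((treeLevel_spec x).2 w fun y hy => (hcon y hy).symm)

theorem treeLevel_injOn (x : I) : Set.InjOn (treeLevel f h) (treePred f x) := by
  intro y hy z hz hyz
  rcases lt_trichotomy y z with hlt | heq | hlt
  · exact absurd hyz (treeLevel_lt (mem_treePred_of_lt hz y hy hlt)).ne
  · exact heq
  · exact absurd hyz (treeLevel_lt (mem_treePred_of_lt hy z hz hlt)).ne'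

open Classical in
variable (f h) in
/-- The colours that `x` induces on the finite sets of levels below `x`. -/
noncomputable def treeCode (x : I) (w : Finset W) : Λ :=
  -- Levels are injective on a branch, so the choice of `s` is immaterial; `f ∅` is only a default
  -- value.
  if hs : ∃ s : Finset I, (s : Set I) ⊆ treePred f x ∧ s.image (treeLevel f h) = w then
    f (insert x hs.choose) else f ∅

theorem treeCode_image {x : I} {s : Finset I} (hs : (s : Set I) ⊆ treePred f x) :
    treeCode f h x (s.image (treeLevel f h)) = f (insert x s) := by
  have hex : ∃ s' : Finset I, (s' : Set I) ⊆ treePred f x ∧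
      s'.image (treeLevel f h) = s.image (treeLevel f h) := ⟨s, hs, rfl⟩
  rw [treeCode, dif_pos hex]
  have h1 := hex.choose_spec
  have h2 : (hex.choose : Set I) = s := (treeLevel_injOn (h := h) x).image_eq_image_iff h1.1 hs |>.1 (by
    have := congrArg (fun t : Finset W => (t : Set W)) h1.2
    simpa only [Finset.coe_image] using this)
  rw [Finset.coe_injective h2]

/-- By induction on the level, the branches of `x` and `x'` coincide. If two nodes on the same level
have the same predecessors and induce the same colours on them, then the smaller one, were they
distinct, would be a predecessor of the larger one and hence of itself. -/
theorem eq_of_treeCode_eq (h : ∀ x, #(treePred f x) < #W) {x x' : I} (hlev : treeLevel f h x = treeLevel f h x')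
    (hcode : treeCode f h x = treeCode f h x') : x = x' := by
  suffices H : ∀ (w : W) (y y' : I), treeLevel f h y = w → treeLevel f h y' = w →
      y ∈ insert x (treePred f x) → y' ∈ insert x' (treePred f x') → y = y' from
    H _ x x' rfl hlev.symm (Set.mem_insert _ _) (Set.mem_insert _ _)
  have sub : ∀ x y : I, y ∈ insert x (treePred f x) → treePred f y ⊆ treePred f x := by
    rintro x y (rfl | hy)
    · exact subset_rfl
    · exact treePred_subset x y hy
  have col : ∀ x y : I, y ∈ insert x (treePred f x) → ∀ s : Finset I,
      (s : Set I) ⊆ treePred f y → f (insert y s) = f (insert x s) := by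
    rintro x y (rfl | hy) s hs
    · rfl
    · exact (mem_treePred.1 hy).2 s hs
  intro w
  induction w using WellFoundedLT.induction with
  | _ w ih =>
    intro y y' hyw hyw' hy hy'
    have hpred : treePred f y = treePred f y' := by
      ext z
      constructor
      · intro hz
        obtain ⟨z', hz', hzz⟩ := exists_treeLevel_eq (f := f) (h := h) (x := y')
          (w := treeLevel f h z) (by rw [hyw', ← hyw]; exact treeLevel_lt hz)
        rwa [ih _ (by rw [← hyw]; exact treeLevel_lt hz) z z' rfl hzz
          (Or.inr (sub _ _ hy hz)) (Or.inr (sub _ _ hy' hz'))]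
      · intro hz
        obtain ⟨z', hz', hzz⟩ := exists_treeLevel_eq (f := f) (h := h) (x := y)
          (w := treeLevel f h z) (by rw [hyw, ← hyw']; exact treeLevel_lt hz)
        rwa [← ih _ (by rw [← hyw']; exact treeLevel_lt hz) z' z hzz rfl
          (Or.inr (sub _ _ hy hz')) (Or.inr (sub _ _ hy' hz))]
    have hcol : ∀ s : Finset I, (s : Set I) ⊆ treePred f y →
        f (insert y s) = f (insert y' s) := by
      intro s hs
      have hs' : (s : Set I) ⊆ treePred f y' := hpred ▸ hs
      rw [col x y hy s hs, col x' y' hy' s hs', ← treeCode_image (h := h) (hs.trans (sub _ _ hy)),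
        ← treeCode_image (h := h) (hs'.trans (sub _ _ hy')), hcode]
    rcases lt_trichotomy y y' with hlt | heq | hlt
    · have : y ∈ treePred f y' := mem_treePred.2 ⟨hlt, hcol⟩
      exact absurd (mem_treePred.1 (hpred ▸ this)).1 (lt_irrefl y)
    · exact heq
    · have : y' ∈ treePred f y := mem_treePred.2 ⟨hlt, fun s hs => (hcol s (hpred ▸ hs)).symm⟩
      exact absurd (mem_treePred.1 (hpred ▸ this)).1 (lt_irrefl y')

end Level

-- If all branches were shorter than `μ`, level and code would embed `I` into a set of cardinality
-- `μ * #Λ ^ μ`.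
variable (f) in
theorem exists_le_mk_treePred {μ : Cardinal.{u}} (hμ : ℵ₀ ≤ μ) (hI : μ * #Λ ^ μ < #I) :
    ∃ x, μ ≤ #(treePred f x) := by
  by_contra hcon
  push Not at hcon
  have h : ∀ x, #(treePred f x) < #μ.ord.ToType := fun x => by
    rw [Cardinal.mk_ord_toType]; exact hcon x
  have hinf : Infinite μ.ord.ToType := by
    rw [Cardinal.infinite_iff, Cardinal.mk_ord_toType]; exact hμ
  refine hI.not_ge ?_
  have hinj : Function.Injective fun x : I => (treeLevel f h x, treeCode f h x) := by
    intro x x' hxx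
    exact eq_of_treeCode_eq h (congrArg Prod.fst hxx) (congrArg Prod.snd hxx)
  have := mk_le_of_injective hinj
  rwa [mk_prod, lift_id, lift_id, ← power_def, mk_finset_of_infinite,
    Cardinal.mk_ord_toType] at this

end Tree

-- Along a branch below `x`, the colour of a set does not change when its largest element is
-- replaced by `x`. So on a long branch, colouring sets of size `n + 1` by `f` reduces to colouring
-- sets of size `n` by `f (insert x ·)`.
open Classical in
theorem exists_homogeneous {Λ : Type u} {θ : Cardinal.{u}} (hθ : θ.IsStrongLimit)
    (hΛ : #Λ < θ) (hω : ℵ₀ < θ) (n : ℕ) : ∀ μ < θ, ∃ ν < θ, ∀ (I : Type u) [LinearOrder I]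
      [WellFoundedLT I] (f : Finset I → Λ), ν ≤ #I → ∃ H : Set I, μ ≤ #H ∧
        ∃ q, ∀ s : Finset I, (s : Set I) ⊆ H → s.card = n → f s = q := by
  induction n with
  | zero =>
    intro μ hμ
    refine ⟨μ, hμ, fun I _ _ f hI => ⟨Set.univ, by simpa using hI, f ∅, fun s _ hs => ?_⟩⟩
    rw [Finset.card_eq_zero.1 hs]
  | succ n ih =>
    intro μ hμ
    obtain ⟨ν, hν, H⟩ := ih μ hμ
    have hν' : max ν ℵ₀ < θ := max_lt hν hω
    set ν' := max ν ℵ₀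
    have hinf : ℵ₀ ≤ ν' := le_max_right _ _
    have hpow : ν' * #Λ ^ ν' < θ := by
      refine mul_lt_of_lt hω.le hν' (lt_of_le_of_lt ?_
        (hθ.isStrongPrelimit (mul_lt_of_lt hω.le hΛ hν')))
      rw [power_mul]
      exact power_le_power_right (cantor _).le
    refine ⟨Order.succ (ν' * #Λ ^ ν'), hθ.isSuccLimit.succ_lt hpow, fun I _ _ f hI => ?_⟩
    obtain ⟨x, hx⟩ := exists_le_mk_treePred f hinf (Order.succ_le_iff.1 hI)
    obtain ⟨H', hH', q, hq⟩ := H (treePred f x)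
      (fun s => f (insert x (s.map (Function.Embedding.subtype _)))) ((le_max_left _ _).trans hx)
    refine ⟨Subtype.val '' H', by rwa [mk_image_eq Subtype.val_injective], q, fun s hs hcard => ?_⟩
    have hne : s.Nonempty := Finset.card_pos.1 (by omega)
    have hy : s.max' hne ∈ s := s.max'_mem hne
    have hsx : (s : Set I) ⊆ treePred f x := fun z hz => by
      obtain ⟨z', -, rfl⟩ := hs hz
      exact z'.2
    have herase : ((s.erase (s.max' hne) : Finset I) : Set I) ⊆ treePred f (s.max' hne) := by
      intro z hz
      exact mem_treePred_of_lt (hsx hy) z (hsx (Finset.mem_of_mem_erase hz))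
        (s.lt_max'_of_mem_erase_max' hne hz)
    rw [← Finset.insert_erase hy, (mem_treePred.1 (hsx hy)).2 _ herase]
    have hsub : ∀ z ∈ s.erase (s.max' hne), z ∈ treePred f x := fun z hz =>
      hsx (Finset.mem_of_mem_erase hz)
    have := hq ((s.erase (s.max' hne)).subtype (· ∈ treePred f x)) (fun z hz => by
      have hz' : (z : I) ∈ s := Finset.mem_of_mem_erase (Finset.mem_subtype.1 hz)
      obtain ⟨z'', hz'', hzz⟩ := hs hz'
      rwa [← Subtype.ext hzz]) (by
        rw [Finset.card_subtype, Finset.filter_true_of_mem hsub, Finset.card_erase_of_mem hy,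
          hcard]
        rfl)
    rwa [Finset.subtype_map_of_mem hsub] at this

open Classical in
/-- A form of the Erdős–Rado theorem: if `κ` is a fixed point of the beth function, then there
is a well-order of cardinality less than `κ` such that each colouring of its finite subsets by
a fixed set of less than `κ` colours has arbitrarily large finite homogeneous sets, whose
colours do not depend on the homogeneous set. -/
theorem exists_wellOrder_homogeneous {κ : Cardinal.{u}} (hκ : beth κ.ord = κ) {Λ : Type u}
    (hΛ : #Λ < κ) : ∃ (I : Type u) (_ : LinearOrder I) (_ : WellFoundedLT I), #I < κ ∧
      ∀ f : Finset I → Λ, ∃ q : ℕ → Λ, ∀ N, ∃ s : Finset I, s.card = N ∧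
        ∀ t ⊆ s, f t = q t.card := by
  have hω : ℵ₀ ≤ κ := hκ ▸ aleph0_le_beth _
  have hlim : Order.IsSuccLimit κ.ord := isSuccLimit_ord hω
  have hκs : κ.IsStrongLimit := hκ ▸ isStrongLimit_beth.2 hlim.isSuccPrelimit
  have hω' : ℵ₀ < κ := by
    have := beth_strictMono (hlim.bot_lt)
    rwa [hκ, Ordinal.bot_eq_zero, beth_zero] at this
  -- As `c` is regular and exceeds `#Λ`, families of cardinals below `θ = beth c.ord` indexed by `Λ`
  -- are bounded below `θ` (`hsup`). The fixed point `κ` itself may be singular, so it could not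
  -- replace `θ`.
  set c : Cardinal.{u} := Order.succ (max #Λ ℵ₀) with hc
  have hcreg : c.IsRegular := isRegular_succ (le_max_right _ _)
  have hcκ : c < κ := hκs.isSuccLimit.succ_lt (max_lt hΛ hω')
  have hΛc : #Λ < c := (le_max_left _ _).trans_lt (Order.lt_succ _)
  have hclim : Order.IsSuccLimit c.ord := isSuccLimit_ord hcreg.aleph0_le
  set θ := beth c.ord with hθdef
  have hθ : θ.IsStrongLimit := isStrongLimit_beth.2 hclim.isSuccPrelimit
  have hθκ : θ < κ := by
    rw [← hκ]; exact beth_strictMono (ord_lt_ord.2 hcκ)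
  have hcθ : c ≤ θ := le_beth_ord c
  have hΛθ : #Λ < θ := hΛc.trans_le hcθ
  have hωθ : ℵ₀ < θ := (lt_of_le_of_lt (le_max_right _ _) (Order.lt_succ (max #Λ ℵ₀))).trans_le hcθ
  have hsup : ∀ m : Λ → Cardinal.{u}, (∀ q, m q < θ) → ∃ μ < θ, ∀ q, m q ≤ μ := by
    intro m hm
    have : ∀ q, ∃ o < c.ord, m q < beth o := fun q => by
      have := hm q
      rw [hθdef, beth_limit hclim] at this
      obtain ⟨o, ho⟩ := exists_lt_of_lt_ciSup' this
      exact ⟨o, o.2, ho⟩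
    choose o ho hmo using this
    refine ⟨beth (⨆ q, o q), beth_strictMono (Ordinal.iSup_lt_of_lt_cof (by rwa [hcreg.cof_ord]) ho),
      fun q => (hmo q).le.trans (beth_mono (Ordinal.le_iSup o q))⟩
  refine ⟨θ.ord.ToType, inferInstance, inferInstance, by rwa [mk_ord_toType], fun f => ?_⟩
  -- Only `q k` for `k < n` matters. Homogeneous sets of every size below `θ` are demanded, so that
  -- they can be thinned out again at the next step.
  let Good (n : ℕ) (q : ℕ → Λ) : Prop := ∀ μ < θ, ∃ H : Set θ.ord.ToType, μ ≤ #H ∧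
    ∀ s : Finset θ.ord.ToType, (s : Set θ.ord.ToType) ⊆ H → s.card < n → f s = q s.card
  -- If each colour `c` failed at some size `m c < θ`, a homogeneous set at least as large as all
  -- the `m c` would refute the failure of its own colour.
  have hstep : ∀ n q, Good n q → ∃ c, Good (n + 1) (Function.update q n c) := by
    intro n q hq
    by_contra hcon
    push Not at hcon
    have hcon' : ∀ c, ∃ μ < θ, ∀ H : Set θ.ord.ToType, μ ≤ #H → ¬ ∀ s : Finset θ.ord.ToType,
        (s : Set θ.ord.ToType) ⊆ H → s.card < n + 1 →
          f s = Function.update q n c s.card := by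
      intro c
      have := hcon c
      simp only [Good] at this
      push Not at this
      obtain ⟨μ, hμ, h⟩ := this
      refine ⟨μ, hμ, fun H hH hall => ?_⟩
      obtain ⟨s, h1, h2, h3⟩ := h H hH
      exact h3 (hall s h1 h2)
    choose m hmθ hm using hcon'
    obtain ⟨μ, hμ, hmμ⟩ := hsup m hmθ
    obtain ⟨ν, hν, hhom⟩ := exists_homogeneous hθ hΛθ hωθ n μ hμ
    obtain ⟨H, hH, hHq⟩ := hq ν hν
    obtain ⟨H', hH', c, hc⟩ := hhom H (fun s => f (s.map (Function.Embedding.subtype _))) hH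
    refine hm c (Subtype.val '' H') ?_ fun s hs hcard => ?_
    · rw [mk_image_eq Subtype.val_injective]
      exact (hmμ c).trans hH'
    · have hsH : ∀ z ∈ s, z ∈ H := fun z hz => by
        obtain ⟨z', -, rfl⟩ := hs hz
        exact z'.2
      rcases Nat.lt_succ_iff_lt_or_eq.1 hcard with hlt | heq
      · rw [Function.update_of_ne hlt.ne]
        exact hHq s hsH hlt
      · rw [heq, Function.update_self]
        have := hc (s.subtype (· ∈ H)) (fun z hz => by
          obtain ⟨z'', hz'', hzz⟩ := hs (Finset.mem_subtype.1 hz)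
          rwa [← Subtype.ext hzz]) (by
            rw [Finset.card_subtype, Finset.filter_true_of_mem hsH, heq])
        rwa [Finset.subtype_map_of_mem hsH] at this
  have : Nonempty Λ := ⟨f ∅⟩
  choose! nxt hnxt using hstep
  let Q : ∀ n, {q : ℕ → Λ // Good n q} := fun n => Nat.rec
    ⟨fun _ => f ∅, fun μ hμ => ⟨Set.univ, by rw [mk_univ, mk_ord_toType]; exact hμ.le,
      fun s _ hs => absurd hs (Nat.not_lt_zero _)⟩⟩
    (fun n q => ⟨Function.update q.1 n (nxt n q.1), hnxt n q.1 q.2⟩) n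
  have hQ : ∀ n k, k < n → (Q n).1 k = (Q (k + 1)).1 k := by
    intro n k hk
    induction n with
    | zero => omega
    | succ n ih =>
      rcases Nat.lt_succ_iff_lt_or_eq.1 hk with hlt | rfl
      · rw [← ih hlt]
        exact Function.update_of_ne hlt.ne _ _
      · rfl
  refine ⟨fun k => (Q (k + 1)).1 k, fun N => ?_⟩
  obtain ⟨H, hH, hHq⟩ := (Q (N + 1)).2 N (natCast_lt_aleph0 (n := N) |>.trans hωθ)
  obtain ⟨s, hsH, hs⟩ : ∃ s : Finset θ.ord.ToType, (s : Set θ.ord.ToType) ⊆ H ∧ s.card = N := by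
    obtain ⟨g⟩ : Nonempty (ULift.{u} (Fin N) ↪ H) := by
      rw [← Cardinal.le_def]; simpa using hH
    refine ⟨(Finset.univ.map g).map (Function.Embedding.subtype _), fun z hz => ?_, by simp⟩
    simp only [Finset.coe_map, Set.mem_image] at hz
    obtain ⟨z', -, rfl⟩ := hz
    exact z'.2
  refine ⟨s, hs, fun t ht => ?_⟩
  have hcard : t.card < N + 1 := Nat.lt_succ_of_le (hs ▸ Finset.card_le_card ht)
  rw [hHq t (fun z hz => hsH (ht hz)) hcard, hQ _ _ hcard]

end ErdosRado

/-! ### The number of formulas -/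

namespace ManySorted

section Counting

theorem mk_sigma_le {ι : Type u} {f : ι → Type u} {μ : Cardinal.{u}} (hμ : ℵ₀ ≤ μ)
    (hι : #ι ≤ μ) (hf : ∀ i, #(f i) ≤ μ) : #(Σ i, f i) ≤ μ := by
  rw [mk_sigma]
  refine (sum_le_sum _ (fun _ => μ) hf).trans ?_
  rw [sum_const']
  exact mul_le_of_le hμ hι le_rfl

variable (L : Language.{u})

/-- The finite contexts of a language: the sorts of finitely many variables. -/
abbrev Ctx : Type u := Σ n : ℕ, Fin n → L.Srt

theorem mk_ctx_le {μ : Cardinal.{u}} (hμ : ℵ₀ ≤ μ) (hL : L.card ≤ μ) : #(Ctx L) ≤ μ := by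
  have h : #L.Srt ≤ μ := le_trans (by rw [Language.card, add_assoc]; exact self_le_add_right _ _) hL
  exact (mk_congr List.equivSigmaTuple.symm).trans_le
    ((mk_list_le_max _).trans (max_le hμ h))

variable {L} {n : ℕ} (Γ : Fin n → L.Srt)

/-- The arities of the nodes of the tree coding a term. -/
def TermArity : (Fin n ⊕ Σ (k : ℕ) (Δ : Fin k → L.Srt) (s : L.Srt), L.Fn k Δ s) → Type
  | .inl _ => Empty
  | .inr x => Fin x.1

instance : ∀ a, Finite (TermArity (L := L) (n := n) a)
  | .inl _ => inferInstanceAs (Finite Empty)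
  | .inr x => inferInstanceAs (Finite (Fin x.1))

variable {Γ}

/-- A term as a tree. -/
def Term.code : {s : L.Srt} → Term L Γ s → WType (TermArity (L := L) (n := n))
  | _, .var i => ⟨.inl i, Empty.elim⟩
  | _, .app f ts => ⟨.inr ⟨_, _, _, f⟩, fun i => (ts i).code⟩

/-- The sort is part of the injectivity claim so that the induction can compare terms whose sorts
are not yet known to agree. -/
theorem Term.code_injective : Function.Injective
    fun t : Σ s, Term L Γ s => t.2.code := by
  rintro ⟨s, t⟩
  induction t with
  | var i =>
    rintro ⟨s', t'⟩ h
    cases t' with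
    | var j =>
      rw [Sum.inl.inj (WType.mk.inj h).1]
    | app f ts => exact absurd (WType.mk.inj h).1 (by simp)
  | app f ts ih =>
    rintro ⟨s', t'⟩ h
    cases t' with
    | var j => exact absurd (WType.mk.inj h).1 (by simp)
    | app f' ts' =>
      obtain ⟨h1, h2⟩ := WType.mk.inj h
      cases h1
      have : ts = ts' := by
        funext i
        have := ih i (a₂ := ⟨_, ts' i⟩) (congrFun (eq_of_heq h2) i)
        exact eq_of_heq (Sigma.mk.inj this).2
      rw [this]

theorem mk_term_le {μ : Cardinal.{u}} (hμ : ℵ₀ ≤ μ) (hL : L.card ≤ μ) :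
    #(Σ s, Term L Γ s) ≤ μ := by
  refine (mk_le_of_injective Term.code_injective).trans ?_
  refine WType.cardinalMk_le_max_aleph0_of_finite'.trans (max_le ?_ hμ)
  rw [lift_id'.{0, u}, mk_sum]
  refine add_le_of_le hμ ?_ ?_
  · simpa using (natCast_lt_aleph0 (n := n)).le.trans hμ
  · rw [lift_uzero]
    refine le_trans ?_ hL
    rw [Language.card, add_assoc]
    exact (self_le_add_right _ _).trans (self_le_add_left _ _)

variable (L) in
/-- The labels of the nodes of the tree coding a formula. -/
abbrev FormulaLabel : Type u :=
  (Σ Γ : Ctx L, (Σ s, Term L Γ.2 s) × (Σ s, Term L Γ.2 s)) ⊕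
  (Σ (Γ : Ctx L) (R : Σ (k : ℕ) (Δ : Fin k → L.Srt), L.Rl k Δ), Fin R.1 → Σ s, Term L Γ.2 s) ⊕
  Ctx L ⊕ Ctx L ⊕ (Ctx L × L.Srt)

/-- The arities of the nodes of the tree coding a formula. -/
def FormulaArity : FormulaLabel L → Type
  | .inl _ => Empty
  | .inr (.inl _) => Empty
  | .inr (.inr (.inl _)) => Empty
  | .inr (.inr (.inr (.inl _))) => Bool
  | .inr (.inr (.inr (.inr _))) => Unit

instance : ∀ a, Finite (FormulaArity (L := L) a)
  | .inl _ => inferInstanceAs (Finite Empty)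
  | .inr (.inl _) => inferInstanceAs (Finite Empty)
  | .inr (.inr (.inl _)) => inferInstanceAs (Finite Empty)
  | .inr (.inr (.inr (.inl _))) => inferInstanceAs (Finite Bool)
  | .inr (.inr (.inr (.inr _))) => inferInstanceAs (Finite Unit)

/-- A formula as a tree. -/
def Formula.code : {n : ℕ} → {Γ : Fin n → L.Srt} → Formula L n Γ →
    WType (FormulaArity (L := L))
  | n, Γ, .equal t₁ t₂ => ⟨.inl ⟨⟨n, Γ⟩, ⟨_, t₁⟩, ⟨_, t₂⟩⟩, Empty.elim⟩
  | n, Γ, .rel R ts => ⟨.inr (.inl ⟨⟨n, Γ⟩, ⟨_, _, R⟩, fun i => ⟨_, ts i⟩⟩), Empty.elim⟩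
  | n, Γ, .falsum => ⟨.inr (.inr (.inl ⟨n, Γ⟩)), Empty.elim⟩
  | n, Γ, .imp φ ψ => ⟨.inr (.inr (.inr (.inl ⟨n, Γ⟩))),
      fun b => Bool.rec φ.code ψ.code (b : Bool)⟩
  | n, Γ, .all s φ => ⟨.inr (.inr (.inr (.inr (⟨n, Γ⟩, s)))), fun _ => φ.code⟩

theorem Formula.code_injective : Function.Injective
    fun t : Σ (n : ℕ) (Γ : Fin n → L.Srt), Formula L n Γ => t.2.2.code := by
  rintro ⟨n, Γ, φ⟩
  induction φ with
  | equal t₁ t₂ =>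
    rintro ⟨n', Γ', φ'⟩ h
    cases φ' with
    | equal t₁' t₂' =>
      obtain ⟨h, -⟩ := WType.mk.inj h
      cases h
      rfl
    | _ => exact absurd (WType.mk.inj h).1 (by simp)
  | rel R ts =>
    rintro ⟨n', Γ', φ'⟩ h
    cases φ' with
    | rel R' ts' =>
      obtain ⟨h, -⟩ := WType.mk.inj h
      obtain ⟨h1, h2⟩ := Sigma.mk.inj (Sum.inl.inj (Sum.inr.inj h))
      cases h1
      obtain ⟨h1, h3⟩ := Sigma.mk.inj (eq_of_heq h2)
      cases h1
      have : ts = ts' := by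
        funext i
        exact eq_of_heq (Sigma.mk.inj (congrFun (eq_of_heq h3) i)).2
      rw [this]
    | _ => exact absurd (WType.mk.inj h).1 (by simp)
  | falsum =>
    rintro ⟨n', Γ', φ'⟩ h
    cases φ' with
    | falsum =>
      obtain ⟨h, -⟩ := WType.mk.inj h
      cases h
      rfl
    | _ => exact absurd (WType.mk.inj h).1 (by simp)
  | imp φ ψ ihφ ihψ =>
    rintro ⟨n', Γ', φ'⟩ h
    cases φ' with
    | imp φ' ψ' =>
      obtain ⟨h, h'⟩ := WType.mk.inj h
      cases h
      have h1 := ihφ (a₂ := ⟨_, _, φ'⟩) (congrFun (eq_of_heq h') false)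
      have h2 := ihψ (a₂ := ⟨_, _, ψ'⟩) (congrFun (eq_of_heq h') true)
      cases h1
      cases h2
      rfl
    | _ => exact absurd (WType.mk.inj h).1 (by simp)
  | all s φ ih =>
    rintro ⟨n', Γ', φ'⟩ h
    cases φ' with
    | all s' φ' =>
      obtain ⟨h, h'⟩ := WType.mk.inj h
      cases h
      have h1 := ih (a₂ := ⟨_, _, φ'⟩) (congrFun (eq_of_heq h') ())
      cases h1
      rfl
    | _ => exact absurd (WType.mk.inj h).1 (by simp)

/-- Formulas are finitely branching trees with at most `μ` labels. The bound serves to count types.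
-/
theorem mk_formula_le {μ : Cardinal.{u}} (hμ : ℵ₀ ≤ μ) (hL : L.card ≤ μ) :
    #(Σ (n : ℕ) (Γ : Fin n → L.Srt), Formula L n Γ) ≤ μ := by
  have hctx := mk_ctx_le L hμ hL
  have hsrt : #L.Srt ≤ μ :=
    le_trans (by rw [Language.card, add_assoc]; exact self_le_add_right _ _) hL
  have hrl : #(Σ (k : ℕ) (Δ : Fin k → L.Srt), L.Rl k Δ) ≤ μ :=
    le_trans (by rw [Language.card]; exact self_le_add_left _ _) hL
  refine (mk_le_of_injective Formula.code_injective).trans ?_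
  refine WType.cardinalMk_le_max_aleph0_of_finite'.trans (max_le ?_ hμ)
  rw [lift_id'.{0, u}]
  simp only [mk_sum, lift_id, mk_prod]
  refine add_le_of_le hμ ?_ (add_le_of_le hμ ?_ (add_le_of_le hμ hctx (add_le_of_le hμ hctx ?_)))
  · refine mk_sigma_le hμ hctx fun Γ => ?_
    simp only [mk_prod, lift_id]
    exact mul_le_of_le hμ (mk_term_le hμ hL) (mk_term_le hμ hL)
  · refine mk_sigma_le hμ hctx fun Γ => mk_sigma_le hμ hrl fun R => ?_
    rw [mk_arrow, lift_id', mk_fin, lift_natCast]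
    exact (power_le_power_right (mk_term_le hμ hL)).trans (power_nat_le hμ)
  · exact mul_le_of_le hμ hctx hsrt

end Counting

/-! ### Automorphisms -/

section Automorphisms

variable {L : Language.{u}} {M : L.Srt → Type u} [Struct L M]

/-- The identity automorphism. -/
def Aut.id (L : Language.{u}) (M : L.Srt → Type u) [Struct L M] : Aut L M where
  toEquiv _ := Equiv.refl _
  map_fn _ _ := rfl
  map_rl _ _ := Iff.rfl

/-- The composition of two automorphisms. -/
def Aut.comp (g h : Aut L M) : Aut L M where
  toEquiv s := (h.toEquiv s).trans (g.toEquiv s)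
  map_fn f v := by simp [h.map_fn, g.map_fn]
  map_rl R v := (g.map_rl R fun i => h.toEquiv _ (v i)).trans (h.map_rl R v)

/-- The inverse of an automorphism. -/
def Aut.inv (g : Aut L M) : Aut L M where
  toEquiv s := (g.toEquiv s).symm
  map_fn f v := by
    rw [Equiv.symm_apply_eq, g.map_fn]
    simp
  map_rl R v := by
    rw [← g.map_rl]
    simp

@[simp] theorem Aut.comp_act (g h : Aut L M) (x : Elem M) :
    (g.comp h).act x = g.act (h.act x) := rfl

@[simp] theorem Aut.inv_act_act (g : Aut L M) (x : Elem M) : g.inv.act (g.act x) = x :=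
  Sigma.ext rfl (heq_of_eq ((g.toEquiv x.1).symm_apply_apply x.2))

@[simp] theorem Aut.act_inv_act (g : Aut L M) (x : Elem M) : g.act (g.inv.act x) = x :=
  Sigma.ext rfl (heq_of_eq ((g.toEquiv x.1).apply_symm_apply x.2))

theorem Aut.Fixes.mono {g : Aut L M} {A B : Set (Elem M)} (h : g.Fixes B) (hAB : A ⊆ B) :
    g.Fixes A := fun a ha => h a (hAB ha)

theorem Aut.Fixes.inv {g : Aut L M} {B : Set (Elem M)} (h : g.Fixes B) : g.inv.Fixes B :=
  fun b hb => by
    conv_lhs => rw [← h b hb]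
    exact g.inv_act_act b

theorem Aut.Fixes.comp {g h : Aut L M} {B : Set (Elem M)} (hg : g.Fixes B) (hh : h.Fixes B) :
    (g.comp h).Fixes B := fun b hb => by rw [comp_act, hh b hb, hg b hb]

theorem Aut.Fixes.image_eq {g : Aut L M} {B : Set (Elem M)} (h : g.Fixes B) :
    g.act '' B = B := by
  ext x
  constructor
  · rintro ⟨b, hb, rfl⟩
    rwa [h b hb]
  · exact fun hx => ⟨x, hx, h x hx⟩

theorem Aut.inv_image_image (g : Aut L M) (A : Set (Elem M)) : g.inv.act '' (g.act '' A) = A := by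
  simp [Set.image_image]

theorem Term.eval_aut (g : Aut L M) {n : ℕ} {Γ : Fin n → L.Srt} {s : L.Srt} (t : Term L Γ s)
    (v : ∀ i, M (Γ i)) :
    t.eval (fun i => g.toEquiv (Γ i) (v i)) = g.toEquiv s (t.eval v) := by
  induction t with
  | var i => rfl
  | app f ts ih =>
    simp only [Term.eval, g.map_fn]
    congr 1
    funext i
    exact ih i

theorem consTuple_aut (g : Aut L M) {n : ℕ} {Γ : Fin n → L.Srt} {s : L.Srt} (m : M s)
    (v : ∀ i, M (Γ i)) : consTuple (g.toEquiv s m) (fun i => g.toEquiv (Γ i) (v i)) =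
      fun i => g.toEquiv _ (consTuple m v i) := by
  funext i
  refine Fin.cases ?_ (fun i => ?_) i <;> rfl

theorem Formula.realize_aut (g : Aut L M) {n : ℕ} {Γ : Fin n → L.Srt} (φ : Formula L n Γ)
    (v : ∀ i, M (Γ i)) : φ.Realize (fun i => g.toEquiv (Γ i) (v i)) ↔ φ.Realize v := by
  induction φ with
  | equal t₁ t₂ => simp only [Formula.Realize, Term.eval_aut, EmbeddingLike.apply_eq_iff_eq]
  | rel R ts => simp only [Formula.Realize, Term.eval_aut, g.map_rl]
  | falsum => exact Iff.rfl
  | imp φ ψ ihφ ihψ => simp only [Formula.Realize, ihφ, ihψ]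
  | all s φ ih =>
    simp only [Formula.Realize]
    constructor
    · intro h m
      rw [← ih, ← consTuple_aut]
      exact h _
    · intro h m
      rw [← (g.toEquiv s).apply_symm_apply m, consTuple_aut, ih]
      exact h _

theorem Formula.realize_consTuple_aut (g : Aut L M) {n : ℕ} {Γ : Fin n → L.Srt} {s : L.Srt}
    (φ : Formula L (n + 1) (Fin.cons s Γ)) (m : M s) (v : ∀ i, M (Γ i)) :
    φ.Realize (consTuple (g.toEquiv s m) fun i => g.toEquiv (Γ i) (v i)) ↔
      φ.Realize (consTuple m v) := by
  rw [consTuple_aut, φ.realize_aut]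

end Automorphisms

/-! ### Sets of tuples that are definable without parameters -/

section Definability

variable {L : Language.{u}} {M : L.Srt → Type u} [Struct L M]

-- Values are compared in `Elem M`, since the sorts of corresponding variables agree only
-- propositionally.
variable (M) in
theorem Term.exists_rename {n : ℕ} {Γ : Fin n → L.Srt} {s : L.Srt} (t : Term L Γ s) {m : ℕ}
    (Δ : Fin m → L.Srt) (ρ : Fin n → Fin m) (h : ∀ i, Δ (ρ i) = Γ i) :
    ∃ t' : Term L Δ s, ∀ (v : ∀ i, M (Δ i)) (v' : ∀ i, M (Γ i)),
      (∀ i, (⟨Δ (ρ i), v (ρ i)⟩ : Elem M) = ⟨Γ i, v' i⟩) → t'.eval v = t.eval v' := by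
  induction t with
  | var i =>
    have : ∀ s, Δ (ρ i) = s → ∃ t' : Term L Δ s, ∀ (v : ∀ i, M (Δ i)) (x : M s),
        (⟨Δ (ρ i), v (ρ i)⟩ : Elem M) = ⟨s, x⟩ → t'.eval v = x := by
      rintro _ rfl
      exact ⟨.var (ρ i), fun v x hx => eq_of_heq (Sigma.mk.inj hx).2⟩
    obtain ⟨t', ht'⟩ := this _ (h i)
    exact ⟨t', fun v v' hv => ht' v _ (hv i)⟩
  | app f ts ih =>
    choose ts' hts' using ih
    refine ⟨.app f ts', fun v v' hv => ?_⟩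
    simp only [Term.eval]
    congr 1
    funext i
    exact hts' i v v' hv

variable (M) in
theorem Formula.exists_rename {n : ℕ} {Γ : Fin n → L.Srt} (φ : Formula L n Γ) :
    ∀ {m : ℕ} (Δ : Fin m → L.Srt) (ρ : Fin n → Fin m) (_ : ∀ i, Δ (ρ i) = Γ i),
    ∃ φ' : Formula L m Δ, ∀ (v : ∀ i, M (Δ i)) (v' : ∀ i, M (Γ i)),
      (∀ i, (⟨Δ (ρ i), v (ρ i)⟩ : Elem M) = ⟨Γ i, v' i⟩) → (φ'.Realize v ↔ φ.Realize v') := by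
  induction φ with
  | equal t₁ t₂ =>
    intro m Δ ρ h
    obtain ⟨t₁', h₁⟩ := t₁.exists_rename M Δ ρ h
    obtain ⟨t₂', h₂⟩ := t₂.exists_rename M Δ ρ h
    exact ⟨.equal t₁' t₂', fun v v' hv => by
      simp only [Formula.Realize, h₁ v v' hv, h₂ v v' hv]⟩
  | rel R ts =>
    intro m Δ ρ h
    choose ts' hts' using fun i => (ts i).exists_rename M Δ ρ h
    exact ⟨.rel R ts', fun v v' hv => by simp only [Formula.Realize, hts' _ v v' hv]⟩
  | falsum => exact fun Δ ρ h => ⟨.falsum, fun v v' hv => Iff.rfl⟩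
  | imp φ ψ ihφ ihψ =>
    intro m Δ ρ h
    obtain ⟨φ', hφ⟩ := ihφ Δ ρ h
    obtain ⟨ψ', hψ⟩ := ihψ Δ ρ h
    exact ⟨.imp φ' ψ', fun v v' hv => by
      simp only [Formula.Realize, hφ v v' hv, hψ v v' hv]⟩
  | all s φ ih =>
    intro m Δ ρ h
    obtain ⟨φ', hφ⟩ := ih (Fin.cons s Δ) (Fin.cases 0 fun i => (ρ i).succ) (by
      intro i
      refine Fin.cases ?_ (fun i => ?_) i
      · rfl
      · exact h i)
    refine ⟨.all s φ', fun v v' hv => forall_congr' fun x => hφ _ _ fun i => ?_⟩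
    refine Fin.cases ?_ (fun i => ?_) i
    · rfl
    · exact hv i

variable {ι : Type u} {σ : ι → L.Srt}

/-- `X` is definable without parameters by a formula in the variables from `S`. -/
def DefinableOn (σ : ι → L.Srt) (S : Set ι) (X : Set (∀ i, M (σ i))) : Prop :=
  ∃ (n : ℕ) (f : Fin n → ι) (φ : Formula L n (fun k => σ (f k))), (∀ k, f k ∈ S) ∧
    ∀ v, v ∈ X ↔ φ.Realize fun k => v (f k)

theorem DefinableOn.mem_congr {S : Set ι} {X : Set (∀ i, M (σ i))} (hX : DefinableOn σ S X)
    {v w : ∀ i, M (σ i)} (h : ∀ i ∈ S, v i = w i) : v ∈ X ↔ w ∈ X := by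
  obtain ⟨n, f, φ, hf, hφ⟩ := hX
  rw [hφ, hφ]
  have : (fun k => v (f k)) = fun k => w (f k) := funext fun k => h _ (hf k)
  rw [this]

theorem DefinableOn.mono {S S' : Set ι} {X : Set (∀ i, M (σ i))} (hX : DefinableOn σ S X)
    (h : S ⊆ S') : DefinableOn σ S' X := by
  obtain ⟨n, f, φ, hf, hφ⟩ := hX
  exact ⟨n, f, φ, fun k => h (hf k), hφ⟩

theorem DefinableOn.exists_finite {S : Set ι} {X : Set (∀ i, M (σ i))}
    (hX : DefinableOn σ S X) : ∃ S' ⊆ S, S'.Finite ∧ DefinableOn σ S' X := by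
  obtain ⟨n, f, φ, hf, hφ⟩ := hX
  exact ⟨range f, by rintro _ ⟨k, rfl⟩; exact hf k, finite_range f, n, f, φ,
    fun k => mem_range_self k, hφ⟩

theorem definableOn_univ (S : Set ι) : DefinableOn σ S (Set.univ : Set (∀ i, M (σ i))) :=
  ⟨0, Fin.elim0, .imp .falsum .falsum, fun k => k.elim0, fun v => by
    simp [Formula.Realize]⟩

theorem DefinableOn.compl {S : Set ι} {X : Set (∀ i, M (σ i))} (hX : DefinableOn σ S X) :
    DefinableOn σ S Xᶜ := by
  obtain ⟨n, f, φ, hf, hφ⟩ := hX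
  exact ⟨n, f, .imp φ .falsum, hf, fun v => by
    rw [Set.mem_compl_iff, hφ]; rfl⟩

theorem DefinableOn.inter {S : Set ι} {X Y : Set (∀ i, M (σ i))} (hX : DefinableOn σ S X)
    (hY : DefinableOn σ S Y) : DefinableOn σ S (X ∩ Y) := by
  obtain ⟨n, f, φ, hf, hφ⟩ := hX
  obtain ⟨n', f', φ', hf', hφ'⟩ := hY
  obtain ⟨ψ, hψ⟩ := φ.exists_rename M (fun k => σ (Fin.append f f' k)) (Fin.castAdd n')
    (fun i => by rw [Fin.append_left])
  obtain ⟨ψ', hψ'⟩ := φ'.exists_rename M (fun k => σ (Fin.append f f' k)) (Fin.natAdd n)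
    (fun i => by rw [Fin.append_right])
  refine ⟨n + n', Fin.append f f', .imp (.imp ψ (.imp ψ' .falsum)) .falsum, fun k => ?_,
    fun v => ?_⟩
  · refine Fin.addCases (fun i => ?_) (fun i => ?_) k
    · rw [Fin.append_left]; exact hf i
    · rw [Fin.append_right]; exact hf' i
  · have h1 := hψ (fun k => v (Fin.append f f' k)) (fun k => v (f k)) (fun i => by
      rw [Fin.append_left])
    have h2 := hψ' (fun k => v (Fin.append f f' k)) (fun k => v (f' k)) (fun i => by
      rw [Fin.append_right])
    simp only [Formula.Realize, h1, h2, Set.mem_inter_iff, hφ, hφ']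
    tauto

theorem DefinableOn.sInter {S : Set ι} {F : Set (Set (∀ i, M (σ i)))} (hF : F.Finite)
    (h : ∀ X ∈ F, DefinableOn σ S X) : DefinableOn σ S (⋂₀ F) := by
  induction F, hF using Set.Finite.induction_on with
  | empty => rw [sInter_empty]; exact definableOn_univ S
  | insert _ _ ih =>
    rw [sInter_insert]
    exact (h _ (mem_insert _ _)).inter (ih fun X hX => h X (mem_insert_of_mem _ hX))

/-- All occurrences of the variable `j` are merged at position `0`, where `Formula.all` and
`DefinableOver` expect their variable. -/
theorem DefinableOn.exists_formula_update [DecidableEq ι] {S : Set ι} {X : Set (∀ i, M (σ i))}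
    (hX : DefinableOn σ S X) (j : ι) :
    ∃ (n : ℕ) (f : Fin n → ι) (φ : Formula L (n + 1) (Fin.cons (σ j) fun k => σ (f k))),
      (∀ k, f k ∈ S \ {j}) ∧
        ∀ v m, Function.update v j m ∈ X ↔ φ.Realize (consTuple m fun k => v (f k)) := by
  obtain ⟨n, f, φ, hf, hφ⟩ := hX
  let e := Fintype.equivFin {k // f k ≠ j}
  let f' : Fin (Fintype.card {k // f k ≠ j}) → ι := fun k => f (e.symm k)
  let ρ : Fin n → Fin (Fintype.card {k // f k ≠ j} + 1) := fun k =>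
    if h : f k = j then 0 else (e ⟨k, h⟩).succ
  obtain ⟨ψ, hψ⟩ := φ.exists_rename M (Fin.cons (σ j) fun k => σ (f' k)) ρ (by
    intro k
    by_cases h : f k = j
    · simp [ρ, h]
    · simp [ρ, h, f'])
  refine ⟨_, f', ψ, fun k => ⟨hf _, (e.symm k).2⟩, fun v m => ?_⟩
  rw [hφ]
  refine (hψ _ _ fun k => ?_).symm
  have key : ∀ r : Fin (Fintype.card {k // f k ≠ j} + 1), ρ k = r →
      (⟨(Fin.cons (σ j) (fun k => σ (f' k)) : Fin (_ + 1) → L.Srt) r,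
        consTuple m (fun k => v (f' k)) r⟩ : Elem M) =
        ⟨σ (f k), Function.update v j m (f k)⟩ := by
    intro r
    refine Fin.cases (fun hr => ?_) (fun r hr => ?_) r
    · have hk : f k = j := by
        by_contra h
        simp only [ρ, dif_neg h] at hr
        exact Fin.succ_ne_zero _ hr
      rw [hk, Function.update_self]
      rfl
    · have hk : f k ≠ j := by
        intro h
        simp only [ρ, dif_pos h] at hr
        exact Fin.succ_ne_zero _ hr.symm
      simp only [ρ, dif_neg hk, Fin.succ_inj] at hr
      have hfr : f' r = f k := by rw [← hr]; simp [f']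
      rw [Function.update_of_ne hk, ← hfr]
      rfl
  exact key _ rfl

theorem DefinableOn.exists_update [DecidableEq ι] {S : Set ι} {X : Set (∀ i, M (σ i))}
    (hX : DefinableOn σ S X) (j : ι) :
    DefinableOn σ (S \ {j}) {v : ∀ i, M (σ i) | ∃ m, Function.update v j m ∈ X} := by
  obtain ⟨n, f, φ, hf, hφ⟩ := hX.exists_formula_update j
  refine ⟨n, f, .imp (.all _ (.imp φ .falsum)) .falsum, hf, fun v => ?_⟩
  change (∃ m, Function.update v j m ∈ X) ↔
    ((∀ m, φ.Realize (consTuple m fun k => v (f k)) → False) → False)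
  simp only [hφ]
  exact ⟨fun ⟨m, hm⟩ h => h m hm, fun h => by_contra fun h' => h fun m hm => h' ⟨m, hm⟩⟩

theorem DefinableOn.exists_eqOn {S : Set ι} {X : Set (∀ i, M (σ i))} (hX : DefinableOn σ S X)
    {T : Set ι} (hT : T.Finite) :
    DefinableOn σ (S \ T) {v : ∀ i, M (σ i) | ∃ w ∈ X, ∀ i ∉ T, w i = v i} := by
  classical
  induction T, hT using Set.Finite.induction_on with
  | empty =>
    have : {v : ∀ i, M (σ i) | ∃ w ∈ X, ∀ i ∉ (∅ : Set ι), w i = v i} = X := by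
      ext v
      constructor
      · rintro ⟨w, hw, h⟩
        have : w = v := funext fun i => h i (Set.notMem_empty i)
        exact this ▸ hw
      · exact fun hv => ⟨v, hv, fun _ _ => rfl⟩
    rw [this, Set.sdiff_empty]
    exact hX
  | @insert j T hj _ ih =>
    have : {v : ∀ i, M (σ i) | ∃ w ∈ X, ∀ i ∉ insert j T, w i = v i} =
        {v : ∀ i, M (σ i) | ∃ m, Function.update v j m ∈
          {v : ∀ i, M (σ i) | ∃ w ∈ X, ∀ i ∉ T, w i = v i}} := by
      ext v
      constructor
      · rintro ⟨w, hw, h⟩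
        refine ⟨w j, w, hw, fun i hi => ?_⟩
        by_cases hij : i = j
        · subst hij; simp
        · rw [Function.update_of_ne hij]
          exact h i (by simp [hij, hi])
      · rintro ⟨m, w, hw, h⟩
        refine ⟨w, hw, fun i hi => ?_⟩
        rw [Set.mem_insert_iff, not_or] at hi
        rw [h i hi.2, Function.update_of_ne hi.1]
    rw [this]
    refine (ih.exists_update j).mono ?_
    rintro i ⟨⟨h1, h2⟩, h3⟩
    exact ⟨h1, fun h => (Set.mem_insert_iff.1 h).elim h3 h2⟩

theorem DefinableOn.definableOver [DecidableEq ι] {S : Set ι} {X : Set (∀ i, M (σ i))} (hX : DefinableOn σ S X)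
    (j : ι) (c : ∀ i, M (σ i)) {A : Set (Elem M)}
    (hA : ∀ i ∈ S, i ≠ j → (⟨σ i, c i⟩ : Elem M) ∈ A) :
    DefinableOver L A (σ j) {m | Function.update c j m ∈ X} := by
  obtain ⟨n, f, φ, hf, hφ⟩ := hX.exists_formula_update j
  exact ⟨n, fun k => σ (f k), φ, fun k => c (f k), fun k => hA _ (hf k).1 (hf k).2,
    Set.ext fun m => hφ c m⟩

end Definability
/-! ### Saturation and homogeneity for small tuples -/

section BigModel

variable {L : Language.{u}} {M : L.Srt → Type u} [Struct L M] {κ : Cardinal.{u}}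

theorem IsBigModel.aleph0_lt (hM : IsBigModel L M κ) : ℵ₀ < κ := by
  have hω : ℵ₀ ≤ κ := hM.beth_eq ▸ aleph0_le_beth _
  have := beth_strictMono (isSuccLimit_ord hω).bot_lt
  rwa [hM.beth_eq, Ordinal.bot_eq_zero, beth_zero] at this

theorem IsBigModel.isStrongLimit (hM : IsBigModel L M κ) : κ.IsStrongLimit := by
  have := isStrongLimit_beth.2 (isSuccLimit_ord hM.aleph0_lt.le).isSuccPrelimit
  rwa [hM.beth_eq] at this

theorem DefinableOn.comap {ι ι' : Type u} {σ : ι → L.Srt} (e : ι' → ι) {S : Set ι'}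
    {X : Set (∀ i, M (σ (e i)))} (hX : DefinableOn (fun i => σ (e i)) S X) :
    DefinableOn σ (e '' S) {v : ∀ i, M (σ i) | (fun i => v (e i)) ∈ X} := by
  obtain ⟨n, f, φ, hf, hφ⟩ := hX
  exact ⟨n, fun k => e (f k), φ, fun k => mem_image_of_mem e (hf k), fun v => hφ _⟩

theorem DefinableOn.aut_mem_iff {ι : Type u} {σ : ι → L.Srt} {S : Set ι}
    {X : Set (∀ i, M (σ i))} (hX : DefinableOn σ S X) (g : Aut L M) (v : ∀ i, M (σ i)) :
    (fun i => g.toEquiv (σ i) (v i)) ∈ X ↔ v ∈ X := by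
  obtain ⟨n, f, φ, hf, hφ⟩ := hX
  rw [hφ, hφ]
  exact φ.realize_aut g _

theorem IsBigModel.exists_aut (hM : IsBigModel L M κ) {ι : Type u} (hι : #ι < κ)
    (σ : ι → L.Srt) (a b : ∀ i, M (σ i))
    (h : ∀ X, DefinableOn σ Set.univ X → a ∈ X → b ∈ X) :
    ∃ g : Aut L M, ∀ i, g.toEquiv (σ i) (a i) = b i := by
  refine hM.homogeneous ι σ a b hι fun n f φ => ?_
  have hX : DefinableOn σ Set.univ {v : ∀ i, M (σ i) | φ.Realize fun k => v (f k)} :=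
    ⟨n, f, φ, fun _ => mem_univ _, fun v => Iff.rfl⟩
  exact ⟨h _ hX, fun hb => by_contra fun ha => h _ hX.compl ha hb⟩

/-- Saturation in many variables at once. Zorn's lemma yields a maximal partial assignment
compatible with every finite part of `P`. If it left out a variable `j`, the projections to `j` of
the finite parts of `P` would be finitely satisfiable over few parameters, and saturation in one
variable would extend it. -/
theorem IsBigModel.exists_realization (hM : IsBigModel L M κ) {ι : Type u} (hι : #ι < κ)
    (σ : ι → L.Srt) (J₀ : Set ι) (c₀ : ∀ i, M (σ i)) (P : Set (Set (∀ i, M (σ i))))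
    (hP : ∀ X ∈ P, DefinableOn σ Set.univ X)
    (hfin : ∀ F ⊆ P, F.Finite → ∃ v ∈ ⋂₀ F, ∀ i ∈ J₀, v i = c₀ i) :
    ∃ v ∈ ⋂₀ P, ∀ i ∈ J₀, v i = c₀ i := by
  classical
  let Z := {p : Set ι × (∀ i, M (σ i)) // J₀ ⊆ p.1 ∧ (∀ i ∈ J₀, p.2 i = c₀ i) ∧
    ∀ F ⊆ P, F.Finite → ∃ v ∈ ⋂₀ F, ∀ i ∈ p.1, v i = p.2 i}
  let r : Z → Z → Prop := fun p q => p.1.1 ⊆ q.1.1 ∧ ∀ i ∈ p.1.1, q.1.2 i = p.1.2 i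
  have hsupp : ∀ F ⊆ P, F.Finite → ∃ S : Set ι, S.Finite ∧ DefinableOn σ S (⋂₀ F) := by
    intro F hF hFf
    obtain ⟨S, -, hS, hX⟩ :=
      (DefinableOn.sInter hFf fun X hX => hP X (hF hX)).exists_finite
    exact ⟨S, hS, hX⟩
  obtain ⟨⟨⟨J, c⟩, hJ₀, hc₀, hJ⟩, hmax⟩ := exists_maximal_of_chains_bounded (r := r) (by
    intro C hC
    rcases C.eq_empty_or_nonempty with rfl | ⟨p₀, hp₀⟩
    · exact ⟨⟨(J₀, c₀), subset_rfl, fun _ _ => rfl, hfin⟩, fun a ha => ha.elim⟩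
    have hpair : ∀ p ∈ C, ∀ q ∈ C, ∀ i ∈ p.1.1, i ∈ q.1.1 → p.1.2 i = q.1.2 i := by
      intro p hp q hq i hip hiq
      rcases eq_or_ne p q with rfl | hne
      · rfl
      rcases hC hp hq hne with h | h
      · exact (h.2 i hip).symm
      · exact h.2 i hiq
    let J : Set ι := {i | ∃ p ∈ C, i ∈ p.1.1}
    let c : ∀ i, M (σ i) := fun i => if h : ∃ p ∈ C, i ∈ p.1.1 then h.choose.1.2 i else c₀ i
    have hc : ∀ p ∈ C, ∀ i ∈ p.1.1, c i = p.1.2 i := by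
      intro p hp i hi
      have h : ∃ p ∈ C, i ∈ p.1.1 := ⟨p, hp, hi⟩
      simp only [c, dif_pos h]
      exact hpair _ h.choose_spec.1 p hp i h.choose_spec.2 hi
    have hdir : ∀ S : Set ι, S.Finite → S ⊆ J → ∃ p ∈ C, S ⊆ p.1.1 := by
      intro S hS
      induction S, hS using Set.Finite.induction_on with
      | empty => exact fun _ => ⟨p₀, hp₀, empty_subset _⟩
      | @insert i S _ _ ih =>
        intro hSJ
        obtain ⟨p, hp, hSp⟩ := ih fun x hx => hSJ (mem_insert_of_mem _ hx)
        obtain ⟨q, hq, hiq⟩ := hSJ (mem_insert _ _)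
        rcases eq_or_ne p q with rfl | hne
        · exact ⟨p, hp, insert_subset hiq hSp⟩
        rcases hC hp hq hne with h | h
        · exact ⟨q, hq, insert_subset hiq (hSp.trans h.1)⟩
        · exact ⟨p, hp, insert_subset (h.1 hiq) hSp⟩
    refine ⟨⟨(J, c), fun i hi => ⟨p₀, hp₀, p₀.2.1 hi⟩, fun i hi => ?_, fun F hF hFf => ?_⟩,
      fun p hp => ⟨fun i hi => ⟨p, hp, hi⟩, hc p hp⟩⟩
    · exact (hc p₀ hp₀ i (p₀.2.1 hi)).trans (p₀.2.2.1 i hi)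
    -- Membership in `⋂₀ F` depends only on the finite set `S`, and a single member of the chain
    -- already fixes the values on `S ∩ J`.
    · obtain ⟨S, hS, hX⟩ := hsupp F hF hFf
      obtain ⟨p, hp, hSp⟩ := hdir (S ∩ J) (hS.inter_of_left _) inter_subset_right
      obtain ⟨v, hv, hvp⟩ := p.2.2.2 F hF hFf
      refine ⟨fun i => if i ∈ J then c i else v i, (hX.mem_congr fun i hi => ?_).1 hv,
        fun i hi => if_pos hi⟩
      by_cases hiJ : i ∈ J
      · rw [if_pos hiJ, hc p hp i (hSp ⟨hi, hiJ⟩), hvp i (hSp ⟨hi, hiJ⟩)]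
      · rw [if_neg hiJ])
    (fun {p q s} hpq hqs => ⟨hpq.1.trans hqs.1, fun i hi =>
      (hqs.2 i (hpq.1 hi)).trans (hpq.2 i hi)⟩)
  have hJu : ∀ j, j ∈ J := by
    intro j
    by_contra hj
    let Y (F : Set (Set (∀ i, M (σ i)))) : Set (M (σ j)) :=
      {m | ∃ w ∈ ⋂₀ F, (∀ i ∈ J, w i = c i) ∧ w j = m}
    obtain ⟨m, hm⟩ := hM.saturated ((fun i => (⟨σ i, c i⟩ : Elem M)) '' J) (σ j)
      {X | ∃ F ⊆ P, F.Finite ∧ X = Y F} (lt_of_le_of_lt (mk_image_le.trans (mk_set_le _)) hι)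
      (by
        rintro _ ⟨F, hF, hFf, rfl⟩
        obtain ⟨S, hS, hX⟩ := hsupp F hF hFf
        -- Only finitely many variables outside `insert j J` occur. Quantifying them away makes `Y
        -- F` definable over the values of `c` on `J`.
        have hT : (S \ insert j J).Finite := hS.sdiff
        convert (hX.exists_eqOn hT).definableOver j c
          (A := (fun i => (⟨σ i, c i⟩ : Elem M)) '' J) ?_ using 1
        · ext m
          constructor
          · rintro ⟨w, hw, hwJ, rfl⟩
            refine ⟨fun i => if i ∈ S \ insert j J then w i else Function.update c j (w j) i,
              (hX.mem_congr fun i hi => ?_).1 hw, fun i hi => if_neg hi⟩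
            by_cases hiT : i ∈ S \ insert j J
            · rw [if_pos hiT]
            · rw [if_neg hiT]
              have hiJ : i ∈ insert j J := by_contra fun h => hiT ⟨hi, h⟩
              by_cases hij : i = j
              · subst hij; simp
              · rw [Function.update_of_ne hij]
                exact hwJ i (hiJ.resolve_left hij)
          · rintro ⟨w, hw, h⟩
            refine ⟨w, hw, fun i hi => ?_, ?_⟩
            · rw [h i (fun hiT => hiT.2 (Or.inr hi)),
                Function.update_of_ne (fun hij : i = j => hj (hij ▸ hi))]
            · rw [h j (fun hjT => hjT.2 (Or.inl rfl)), Function.update_self]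
        · rintro i ⟨hiS, hiT⟩ hij
          have hiJ : i ∈ insert j J := by_contra fun h => hiT ⟨hiS, h⟩
          exact ⟨i, hiJ.resolve_left hij, rfl⟩)
      (by
        intro G hG hGf
        choose! F hFP hFf hFY using fun X (hX : X ∈ G) => hG hX
        obtain ⟨w, hw, hwJ⟩ := hJ (⋃ X ∈ G, F X) (iUnion₂_subset hFP) (hGf.biUnion hFf)
        refine ⟨w j, fun X hX => ?_⟩
        rw [hFY X hX]
        exact ⟨w, fun Z hZ => hw Z (mem_biUnion hX hZ), hwJ, rfl⟩)
    have hJ' : ∀ F ⊆ P, F.Finite → ∃ v ∈ ⋂₀ F, ∀ i ∈ insert j J,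
        v i = Function.update c j m i := by
      intro F hF hFf
      obtain ⟨w, hw, hwJ, hwj⟩ := hm (Y F) ⟨F, hF, hFf, rfl⟩
      refine ⟨w, hw, fun i hi => ?_⟩
      by_cases hij : i = j
      · subst hij; simpa using hwj
      · rw [Function.update_of_ne hij]
        exact hwJ i (hi.resolve_left hij)
    refine hj ((hmax ⟨(insert j J, Function.update c j m), hJ₀.trans (subset_insert _ _),
      fun i hi => ?_, hJ'⟩ ⟨subset_insert _ _, fun i hi => ?_⟩).1 (mem_insert _ _))
    · change Function.update c j m i = _
      rw [Function.update_of_ne (fun hij : i = j => hj (hij ▸ hJ₀ hi))]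
      exact hc₀ i hi
    · change Function.update c j m i = _
      rw [Function.update_of_ne (fun hij : i = j => hj (hij ▸ hi))]
  refine ⟨c, fun X hX => ?_, hc₀⟩
  obtain ⟨v, hv, hvc⟩ := hJ {X} (singleton_subset_iff.2 hX) (finite_singleton X)
  have : v = c := funext fun i => hvc i (hJu i)
  rw [← this]
  exact hv X rfl

theorem exists_elem_eq {L : Language.{u}} {M : L.Srt → Type u} {s : L.Srt} {x : Elem M} (h : x.1 = s) :
    ∃ y : M s, (⟨s, y⟩ : Elem M) = x := by
  subst h
  exact ⟨x.2, rfl⟩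

/-- There are fewer than `κ` types of tuples of a given small length. -/
theorem IsBigModel.exists_typeCode (hM : IsBigModel L M κ) {ι : Type u} (hι : #ι < κ) :
    ∃ (Λ : Type u) (tp : (ι → Elem M) → Λ), #Λ < κ ∧
      ∀ a b, tp a = tp b → ∃ g : Aut L M, ∀ i, g.act (a i) = b i := by
  refine ⟨(ι → L.Srt) × Set (Σ (n : ℕ) (Γ : Fin n → L.Srt), Formula L n Γ × (Fin n → ι)),
    fun a => (fun i => (a i).1, {p | ∃ v : ∀ k, M (p.2.1 k),
      (∀ k, (⟨p.2.1 k, v k⟩ : Elem M) = a (p.2.2.2 k)) ∧ p.2.2.1.Realize v}), ?_, ?_⟩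
  · have hκ := hM.isStrongLimit
    set μ := max (max ℵ₀ L.card) #ι with hμdef
    have hμ : ℵ₀ ≤ μ := (le_max_left _ _).trans (le_max_left _ _)
    have hL : L.card ≤ μ := (le_max_right _ _).trans (le_max_left _ _)
    have hμκ : μ < κ := max_lt (max_lt hM.aleph0_lt hM.card_lt) hι
    have hsrt : #L.Srt ≤ μ :=
      le_trans (by rw [Language.card, add_assoc]; exact self_le_add_right _ _) hL
    have h1 : #(ι → L.Srt) < κ := by
      rw [← power_def]
      refine lt_of_le_of_lt ?_ (hκ.isStrongPrelimit hμκ)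
      calc #L.Srt ^ #ι ≤ μ ^ #ι := power_le_power_right hsrt
        _ ≤ μ ^ μ := power_le_power_left (aleph0_pos.trans_le hμ).ne' (le_max_right _ _)
        _ = 2 ^ μ := power_self_eq hμ
    have h2 : #(Σ (n : ℕ) (Γ : Fin n → L.Srt), Formula L n Γ × (Fin n → ι)) ≤ μ := by
      have hinj : Function.Injective
          fun p : Σ (n : ℕ) (Γ : Fin n → L.Srt), Formula L n Γ × (Fin n → ι) =>
            ((⟨p.1, p.2.1, p.2.2.1⟩, ⟨p.1, p.2.2.2⟩) :
              (Σ (n : ℕ) (Γ : Fin n → L.Srt), Formula L n Γ) × (Σ n : ℕ, Fin n → ι)) := by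
        rintro ⟨n, Γ, φ, f⟩ ⟨n', Γ', φ', f'⟩ h
        obtain ⟨h1, h2⟩ := Prod.mk.inj h
        cases h1
        cases h2
        rfl
      refine (mk_le_of_injective hinj).trans ?_
      rw [mk_prod, lift_id, lift_id]
      exact mul_le_of_le hμ (mk_formula_le hμ hL)
        ((mk_congr List.equivSigmaTuple.symm).trans_le
          ((mk_list_le_max _).trans (max_le hμ (le_max_right _ _))))
    rw [mk_prod, lift_id, lift_id, mk_set]
    exact mul_lt_of_lt hM.aleph0_lt.le h1 (hκ.isStrongPrelimit (h2.trans_lt hμκ))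
  · intro a b hab
    obtain ⟨hs, ht⟩ := Prod.mk.inj hab
    choose b' hb' using fun i => exists_elem_eq (congrFun hs i).symm
    obtain ⟨g, hg⟩ := hM.exists_aut hι (fun i => (a i).1) (fun i => (a i).2) b' (by
      rintro X ⟨n, f, φ, -, hφ⟩ ha
      rw [hφ] at ha ⊢
      have : (⟨n, fun k => (a (f k)).1, φ, f⟩ :
          Σ (n : ℕ) (Γ : Fin n → L.Srt), Formula L n Γ × (Fin n → ι)) ∈
          {p : Σ (n : ℕ) (Γ : Fin n → L.Srt), Formula L n Γ × (Fin n → ι) |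
            ∃ v : ∀ k, M (p.2.1 k),
            (∀ k, (⟨p.2.1 k, v k⟩ : Elem M) = b (p.2.2.2 k)) ∧ p.2.2.1.Realize v} := by
        rw [← ht]
        exact ⟨fun k => (a (f k)).2, fun k => rfl, ha⟩
      obtain ⟨v, hv, hφv⟩ := this
      have hvb : v = fun k => b' (f k) := funext fun k =>
        eq_of_heq (Sigma.mk.inj ((hv k).trans (hb' (f k)).symm)).2
      rwa [hvb] at hφv)
    exact ⟨g, fun i => by rw [← hb']; exact Sigma.ext rfl (heq_of_eq (hg i))⟩

theorem IsBigModel.exists_typeCode_over (hM : IsBigModel L M κ) {ι : Type u} (hι : #ι < κ)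
    {B : Set (Elem M)} (hB : #B < κ) :
    ∃ (Λ : Type u) (tp : (ι → Elem M) → Λ), #Λ < κ ∧
      ∀ a b, tp a = tp b → ∃ g : Aut L M, g.Fixes B ∧ ∀ i, g.act (a i) = b i := by
  obtain ⟨Λ, tp, hΛ, htp⟩ := hM.exists_typeCode (ι := ι ⊕ B) (by
    rw [mk_sum, lift_id, lift_id]; exact add_lt_of_lt hM.aleph0_lt.le hι hB)
  refine ⟨Λ, fun a => tp (Sum.elim a Subtype.val), hΛ, fun a b hab => ?_⟩
  obtain ⟨g, hg⟩ := htp _ _ hab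
  exact ⟨g, fun b hb => hg (.inr ⟨b, hb⟩), fun i => hg (.inl i)⟩

end BigModel

/-! ### Algebraic closure -/

section Acl

variable {L : Language.{u}} {M : L.Srt → Type u} [Struct L M] {κ : Cardinal.{u}}

theorem acl_mono {A B : Set (Elem M)} (h : A ⊆ B) : acl L A ⊆ acl L B := by
  rintro d ⟨X, ⟨n, Γ, φ, v, hv, hX⟩, hd⟩
  exact ⟨X, ⟨n, Γ, φ, v, fun i => h (hv i), hX⟩, hd⟩

theorem exists_finite_mem_acl {A : Set (Elem M)} {d : Elem M} (hd : d ∈ acl L A) :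
    ∃ A₀ ⊆ A, A₀.Finite ∧ d ∈ acl L A₀ := by
  obtain ⟨X, ⟨n, Γ, φ, v, hv, hX⟩, hd⟩ := hd
  exact ⟨range fun i => (⟨Γ i, v i⟩ : Elem M), by rintro _ ⟨i, rfl⟩; exact hv i,
    finite_range _, X, ⟨n, Γ, φ, v, fun i => ⟨i, rfl⟩, hX⟩, hd⟩

theorem subset_acl (A : Set (Elem M)) : A ⊆ acl L A := by
  rintro ⟨s, x⟩ hx
  refine ⟨{x}, ⟨1, fun _ => s, .equal (.var 0) (.var 1), fun _ => x, fun _ => hx, ?_⟩,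
    finite_singleton x, rfl⟩
  ext m
  exact Iff.rfl

theorem act_mem_acl {A : Set (Elem M)} (g : Aut L M) {d : Elem M} (hd : d ∈ acl L A) :
    g.act d ∈ acl L (g.act '' A) := by
  obtain ⟨X, ⟨n, Γ, φ, v, hv, hX⟩, hfin, hd⟩ := hd
  refine ⟨g.toEquiv d.1 '' X, ⟨n, Γ, φ, fun i => g.toEquiv (Γ i) (v i),
    fun i => ⟨_, hv i, rfl⟩, ?_⟩, hfin.image _, mem_image_of_mem _ hd⟩
  obtain ⟨s, x⟩ := d
  change g.toEquiv s '' X = {m : M s | φ.Realize (consTuple m fun i => g.toEquiv (Γ i) (v i))}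
  ext m
  rw [hX]
  constructor
  · rintro ⟨m, hm, rfl⟩
    exact (φ.realize_consTuple_aut g m v).2 hm
  · intro hm
    refine ⟨(g.toEquiv s).symm m, ?_, (g.toEquiv s).apply_symm_apply m⟩
    refine (φ.realize_consTuple_aut g _ v).1 ?_
    rw [(g.toEquiv s).apply_symm_apply]
    exact hm

theorem Aut.Fixes.image_acl {A : Set (Elem M)} {g : Aut L M} (hg : g.Fixes A) :
    g.act '' acl L A = acl L A := by
  have h : ∀ g : Aut L M, g.Fixes A → ∀ d ∈ acl L A, g.act d ∈ acl L A := fun g hg d hd => by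
    have := act_mem_acl g hd
    rwa [hg.image_eq] at this
  ext d
  constructor
  · rintro ⟨d, hd, rfl⟩
    exact h g hg d hd
  · exact fun hd => ⟨g.inv.act d, h _ hg.inv d hd, g.act_inv_act d⟩

theorem finite_orbit_of_mem_acl {A : Set (Elem M)} {d : Elem M} (hd : d ∈ acl L A) :
    {x | ∃ g : Aut L M, g.Fixes A ∧ g.act d = x}.Finite := by
  obtain ⟨X, ⟨n, Γ, φ, v, hv, hX⟩, hfin, hd⟩ := hd
  refine (hfin.image (fun m => (⟨d.1, m⟩ : Elem M))).subset ?_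
  rintro _ ⟨g, hg, rfl⟩
  refine ⟨g.toEquiv d.1 d.2, ?_, rfl⟩
  rw [hX] at hd ⊢
  have hgv : (fun i => g.toEquiv (Γ i) (v i)) = v := funext fun i =>
    eq_of_heq (Sigma.mk.inj (hg _ (hv i))).2
  have := (φ.realize_consTuple_aut g d.2 v).2 hd
  rwa [hgv] at this

/-- Otherwise the type of `d` over `A`, together with the formulas excluding each point of the
finite orbit, would be realised; homogeneity would then place the realisation in the orbit. -/
theorem IsBigModel.mem_acl_of_finite_orbit (hM : IsBigModel L M κ) {A : Set (Elem M)}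
    (hA : #A < κ) {d : Elem M}
    (hd : {x | ∃ g : Aut L M, g.Fixes A ∧ g.act d = x}.Finite) : d ∈ acl L A := by
  classical
  by_contra hdA
  let O : Set (M d.1) := {y | ∃ g : Aut L M, g.Fixes A ∧ g.act d = ⟨d.1, y⟩}
  have hO : O.Finite := hd.preimage (f := fun y => (⟨d.1, y⟩ : Elem M))
    (sigma_mk_injective.injOn)
  -- The index `none` is the variable; the others name the elements of `A` and of the orbit as
  -- constants.
  let σ : Option (A ⊕ O) → L.Srt := fun i => i.elim d.1 (Sum.elim (fun x => x.1.1) fun _ => d.1)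
  let c : ∀ i, M (σ i)
    | none => d.2
    | some (.inl x) => x.1.2
    | some (.inr y) => y.1
  let e : Option A → Option (A ⊕ O) := Option.map Sum.inl
  let Y : O → Set (∀ i, M (σ i)) := fun y => {v | v none ≠ (v (some (.inr y)) : M d.1)}
  have hY : ∀ y, DefinableOn σ Set.univ (Y y) := fun y =>
    ⟨2, ![none, some (.inr y)], .imp (.equal (s := d.1) (.var 0) (.var 1)) .falsum,
      fun _ => mem_univ _, fun v => Iff.rfl⟩
  have hcard : #(Option (A ⊕ O)) < κ := by
    rw [mk_option, mk_sum, lift_id, lift_id]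
    exact add_lt_of_lt hM.aleph0_lt.le (add_lt_of_lt hM.aleph0_lt.le hA
      (hO.lt_aleph0.trans hM.aleph0_lt)) (one_lt_aleph0.trans hM.aleph0_lt)
  obtain ⟨v, hv, hvc⟩ := hM.exists_realization hcard σ (range some) c
    ({X | DefinableOn σ (range e) X ∧ c ∈ X} ∪ range Y) (by
      rintro X (⟨hX, -⟩ | ⟨y, rfl⟩)
      · exact hX.mono (subset_univ _)
      · exact hY y) (by
      intro F hF hFf
      have hX : DefinableOn σ (range e) (⋂₀ {X ∈ F | DefinableOn σ (range e) X ∧ c ∈ X}) :=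
        DefinableOn.sInter (hFf.subset (sep_subset _ _)) fun X hX => hX.2.1
      -- An `A`-definable set that contains `d` and lies inside the finite orbit would witness `d ∈
      -- acl A`.
      have hinf : ¬ ({m : M d.1 | Function.update c none m ∈
          ⋂₀ {X ∈ F | DefinableOn σ (range e) X ∧ c ∈ X}} ⊆ O) := fun hsub => by
        refine hdA ⟨_, hX.definableOver none c (A := A) ?_, hO.subset hsub, ?_⟩
        · rintro _ ⟨_ | x, rfl⟩ hne
          · exact absurd rfl hne
          · exact x.2
        · intro X hX
          have : Function.update c none d.2 = c := Function.update_eq_self none c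
          rw [this]
          exact hX.2.2
      obtain ⟨m, hm, hmO⟩ := Set.not_subset.1 hinf
      refine ⟨Function.update c none m, fun X hX => ?_, ?_⟩
      · rcases hF hX with h | ⟨y, rfl⟩
        · exact hm X ⟨hX, h⟩
        · intro h
          have hmy : m = y.1 := h
          exact hmO (hmy ▸ y.2)
      · rintro _ ⟨i, rfl⟩
        exact Function.update_of_ne (by simp) _ _)
  obtain ⟨g, hg⟩ := hM.exists_aut (ι := Option A) (by
    rw [mk_option]
    exact add_lt_of_lt hM.aleph0_lt.le hA (one_lt_aleph0.trans hM.aleph0_lt))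
    (fun i => σ (e i)) (fun i => c (e i)) (fun i => v (e i)) (by
      intro X hX hcX
      exact hv _ (Or.inl ⟨(hX.comap e).mono (image_subset_range _ _), hcX⟩))
  have hgA : g.Fixes A := fun x hx => by
    have h1 := hg (some ⟨x, hx⟩)
    have h2 := hvc (some (.inl ⟨x, hx⟩)) (mem_range_self _)
    exact Sigma.ext rfl (heq_of_eq (h1.trans h2))
  have hgd : (v none : M d.1) ∈ O := ⟨g, hgA, Sigma.ext rfl (heq_of_eq (hg none))⟩
  have := hv (Y ⟨_, hgd⟩) (Or.inr ⟨_, rfl⟩)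
  exact this (hvc (some (.inr ⟨_, hgd⟩)) (mem_range_self _)).symm

/-- The parameters of a formula witnessing that `d` is algebraic over `acl A` have finitely many
conjugates over `A`, and each conjugate formula has finitely many solutions. So the orbit of `d` is
finite. -/
theorem IsBigModel.acl_acl (hM : IsBigModel L M κ) {A : Set (Elem M)} (hA : #A < κ) :
    acl L (acl L A) = acl L A := by
  refine Subset.antisymm (fun d hd => hM.mem_acl_of_finite_orbit hA ?_) (subset_acl _)
  obtain ⟨X, ⟨n, Γ, φ, v, hv, hX⟩, hfin, hd⟩ := hd
  have hW : {w : ∀ i, M (Γ i) | ∀ i, w i ∈ {y | ∃ g : Aut L M, g.Fixes A ∧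
      g.act ⟨Γ i, v i⟩ = ⟨Γ i, y⟩}}.Finite := Set.Finite.pi' fun i =>
    (finite_orbit_of_mem_acl (hv i)).preimage (f := fun y => (⟨Γ i, y⟩ : Elem M))
      sigma_mk_injective.injOn
  have hW' : {w : ∀ i, M (Γ i) | ∃ g : Aut L M, g.Fixes A ∧
      w = fun i => g.toEquiv (Γ i) (v i)}.Finite := hW.subset (by
    rintro _ ⟨g, hg, rfl⟩ i
    exact ⟨g, hg, rfl⟩)
  refine (hW'.biUnion (t := fun w => (fun m => (⟨d.1, m⟩ : Elem M)) ''
    {m | φ.Realize (consTuple m w)}) ?_).subset ?_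
  · rintro _ ⟨g, hg, rfl⟩
    refine ((hfin.image (g.toEquiv d.1)).subset fun m hm => ?_).image _
    refine ⟨(g.toEquiv d.1).symm m, ?_, (g.toEquiv d.1).apply_symm_apply m⟩
    rw [hX]
    refine (φ.realize_consTuple_aut g _ v).1 ?_
    rw [(g.toEquiv d.1).apply_symm_apply]
    exact hm
  · rintro _ ⟨g, hg, rfl⟩
    refine mem_biUnion (x := fun i => g.toEquiv (Γ i) (v i)) ⟨g, hg, rfl⟩
      ⟨g.toEquiv d.1 d.2, ?_, rfl⟩
    rw [hX] at hd
    exact (φ.realize_consTuple_aut g d.2 v).2 hd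

/-- There are fewer than `κ` types over `A`, and an algebraic one has finitely many realisations. -/
theorem IsBigModel.mk_acl_lt (hM : IsBigModel L M κ) {A : Set (Elem M)} (hA : #A < κ) :
    #(acl L A) < κ := by
  obtain ⟨Λ, tp, hΛ, htp⟩ := hM.exists_typeCode_over (ι := PUnit.{u + 1})
    (by simpa using one_lt_aleph0.trans hM.aleph0_lt) hA
  refine lt_of_le_of_lt (mk_le_mk_mul_of_mk_preimage_le (c := ℵ₀)
    (fun d : acl L A => tp fun _ => d.1) fun t => ?_) (mul_lt_of_lt hM.aleph0_lt.le hΛ hM.aleph0_lt)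
  rcases ((fun d : acl L A => tp fun _ => d.1) ⁻¹' {t}).eq_empty_or_nonempty with h | ⟨d, hd⟩
  · rw [h]; simp
  · refine (Set.Finite.lt_aleph0 ?_).le
    refine ((finite_orbit_of_mem_acl d.2).preimage (f := Subtype.val)
      Subtype.val_injective.injOn).subset fun d' hd' => ?_
    obtain ⟨g, hg, hgd⟩ := htp _ _ (Eq.trans hd (Eq.symm hd'))
    exact ⟨g, hg, hgd ⟨⟩⟩

end Acl
/-! ### Sequences with prescribed types of finite subsequences -/

section Sequences

variable {L : Language.{u}} {M : L.Srt → Type u} [Struct L M] {κ : Cardinal.{u}}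

theorem exists_strictMonoOn_fin {I : Type u} [LinearOrder I] {S : Set I} (hS : S.Finite) :
    ∃ (N : ℕ) (e : I → Fin N), StrictMonoOn e S := by
  classical
  lift S to Finset I using hS
  refine ⟨S.card + 1, fun i => ⟨(S.filter (· < i)).card,
    Nat.lt_succ_of_le (Finset.card_filter_le _ _)⟩, fun i hi j _ hij => ?_⟩
  refine Fin.mk_lt_mk.2 (Finset.card_lt_card ⟨fun k hk => ?_, fun h => ?_⟩)
  · rw [Finset.mem_filter] at hk ⊢
    exact ⟨hk.1, hk.2.trans hij⟩
  · exact lt_irrefl i (Finset.mem_filter.1 (h (Finset.mem_filter.2 ⟨hi, hij⟩))).2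

/-- The sorts of the entries of a family of tuples followed by an enumeration of `B`. -/
abbrev familySort {ι : Type u} (J : Type*) (σ : ι → L.Srt) (B : Set (Elem M)) :
    (J × ι) ⊕ B → L.Srt :=
  Sum.elim (fun p => σ p.2) fun b => b.1.1

/-- A family of tuples followed by an enumeration of `B`. -/
def familyTuple {ι : Type u} {J : Type*} {σ : ι → L.Srt} (B : Set (Elem M))
    (a : J → ∀ x, M (σ x)) : ∀ i, M (familySort J σ B i)
  | .inl p => a p.1 p.2
  | .inr b => b.1.2

theorem familyTuple_aut {ι : Type u} {J : Type*} {σ : ι → L.Srt} {B : Set (Elem M)}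
    {a b : J → ∀ x, M (σ x)} {g : Aut L M} (hg : g.Fixes B) (S : Set J)
    (h : ∀ j ∈ S, ∀ x, g.toEquiv (σ x) (a j x) = b j x) :
    ∀ i, Sum.elim (fun p : J × ι => p.1 ∈ S) (fun _ : B => True) i →
      g.toEquiv _ (familyTuple B a i) = familyTuple B b i := by
  rintro (⟨j, x⟩ | ⟨y, hy⟩) hi
  · exact h j hi x
  · exact eq_of_heq (Sigma.mk.inj (hg y hy)).2

/-- Compactness: a finite set of conditions mentions finitely many indices in `I`, which embed
increasingly into some `Fin N`, and there `c N` satisfies the conditions. -/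
theorem IsBigModel.exists_sequence_of_sorted (hM : IsBigModel L M κ) {ι : Type u} (hι : #ι < κ)
    {B : Set (Elem M)} (hB : #B < κ) (σ : ι → L.Srt) (c : ∀ N, Fin N → ∀ x, M (σ x))
    (hc : ∀ n N (i : Fin n → Fin N), StrictMono i → ∃ g : Aut L M, g.Fixes B ∧
      ∀ k x, g.toEquiv (σ x) (c n k x) = c N (i k) x)
    (I : Type u) [LinearOrder I] (hI : #I < κ) :
    ∃ b : I → ∀ x, M (σ x), ∀ n (i : Fin n → I), StrictMono i → ∃ g : Aut L M, g.Fixes B ∧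
      ∀ k x, g.toEquiv (σ x) (c n k x) = b (i k) x := by
  classical
  let supp : Set I → Set ((I × ι) ⊕ B) := fun S =>
    {j | Sum.elim (fun p : I × ι => p.1 ∈ S) (fun _ : B => True) j}
  have supp_mono : ∀ {S T : Set I}, S ⊆ T → supp S ⊆ supp T := by
    rintro S T h (p | y) hp
    · exact h hp
    · exact trivial
  let val : ∀ N, (I → Fin N) → ∀ i, M (familySort I σ B i) := fun N e =>
    familyTuple B fun i => c N (e i)
  -- On indices from `S`, both `val N e` and `val N' e'` are conjugate over `B` to `c` at length
  -- `S.card`, so the choice of `e` is irrelevant.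
  have key : ∀ (S : Set I), S.Finite → ∀ X, DefinableOn (familySort I σ B) (supp S) X →
      ∀ N N' (e : I → Fin N) (e' : I → Fin N'), StrictMonoOn e S → StrictMonoOn e' S →
        val N' e' ∈ X → val N e ∈ X := by
    intro S hS X hX N N' e e' he he' hv
    lift S to Finset I using hS
    have hi : StrictMono (S.orderEmbOfFin rfl) := (S.orderEmbOfFin rfl).strictMono
    obtain ⟨g, hg, hgc⟩ := hc _ _ (fun k => e (S.orderEmbOfFin rfl k)) fun k l hkl =>
      he (S.orderEmbOfFin_mem rfl k) (S.orderEmbOfFin_mem rfl l) (hi hkl)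
    obtain ⟨g', hg', hgc'⟩ := hc _ _ (fun k => e' (S.orderEmbOfFin rfl k)) fun k l hkl =>
      he' (S.orderEmbOfFin_mem rfl k) (S.orderEmbOfFin_mem rfl l) (hi hkl)
    rw [← hX.aut_mem_iff (g.comp g'.inv)] at hv
    refine (hX.mem_congr (familyTuple_aut (hg.comp hg'.inv) (S : Set I) ?_)).1 hv
    intro j hj x
    obtain ⟨k, rfl⟩ : ∃ k, S.orderEmbOfFin rfl k = j := by
      have : j ∈ range (S.orderEmbOfFin rfl) := by
        rw [Finset.range_orderEmbOfFin]; exact hj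
      exact this
    change g.toEquiv _ ((g'.toEquiv _).symm _) = _
    rw [← hgc', Equiv.symm_apply_apply, hgc]
  let P : Set (Set (∀ i, M (familySort I σ B i))) := {X | ∃ S : Set I, S.Finite ∧
    DefinableOn (familySort I σ B) (supp S) X ∧
      ∃ N, ∃ e : I → Fin N, StrictMonoOn e S ∧ val N e ∈ X}
  obtain ⟨v, hv, hvB⟩ := hM.exists_realization (ι := (I × ι) ⊕ B) (by
      simp only [mk_sum, mk_prod, lift_id]
      exact add_lt_of_lt hM.aleph0_lt.le (mul_lt_of_lt hM.aleph0_lt.le hI hι) hB)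
    -- Only the entries naming `B` are prescribed, and these are the same in every `val N e`.
    (familySort I σ B) (range Sum.inr) (val 1 fun _ => 0) P
    (by
      rintro X ⟨S, -, hX, -⟩
      exact hX.mono (subset_univ _))
    (by
      intro F hF hFf
      choose! S hSf hSX N e he heX using fun X (hX : X ∈ F) => hF hX
      obtain ⟨N', e', he'⟩ := exists_strictMonoOn_fin (hFf.biUnion hSf)
      refine ⟨val N' e', fun X hX => ?_, ?_⟩
      · exact key (S X) (hSf X hX) X (hSX X hX) _ _ _ _
          (he'.mono (subset_biUnion_of_mem hX)) (he X hX) (heX X hX)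
      · rintro _ ⟨y, rfl⟩
        rfl)
  refine ⟨fun i x => v (.inl (i, x)), fun n i hi => ?_⟩
  let E : (Fin n × ι) ⊕ B → (I × ι) ⊕ B := Sum.map (Prod.map i _root_.id) _root_.id
  obtain ⟨N, e, he⟩ := exists_strictMonoOn_fin (finite_range i)
  obtain ⟨g₀, hg₀, hgc₀⟩ := hc n N (fun k => e (i k)) fun k l hkl =>
    he (mem_range_self k) (mem_range_self l) (hi hkl)
  have hEsort : (fun j => familySort I σ B (E j)) = familySort (Fin n) σ B := by
    funext j
    rcases j with j | j <;> rfl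
  obtain ⟨g, hg⟩ := hM.exists_aut (ι := (Fin n × ι) ⊕ B) (by
      simp only [mk_sum, mk_prod, lift_id, lift_uzero]
      refine add_lt_of_lt hM.aleph0_lt.le (mul_lt_of_lt hM.aleph0_lt.le ?_ hι) hB
      simpa using natCast_lt_aleph0.trans hM.aleph0_lt)
    (familySort (Fin n) σ B) (familyTuple B (c n))
    (familyTuple B fun k x => v (.inl (i k, x))) (by
      intro X hX ha
      rw [← hX.aut_mem_iff g₀] at ha
      have ha' : familyTuple B (fun k => c N (e (i k))) ∈ X :=
        (hX.mem_congr fun j _ => familyTuple_aut hg₀ Set.univ (fun k _ x => hgc₀ k x) j (by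
          rcases j with j | j <;> exact trivial)).1 ha
      obtain ⟨m, f, φ, -, hφ⟩ := hX
      obtain ⟨φ', hφ'⟩ := φ.exists_rename M (fun k => familySort I σ B (E (f k))) _root_.id
        (fun k => congrFun hEsort (f k))
      have hval : ∀ w : ∀ i, M (familySort I σ B i), (∀ y : B, w (.inr y) = y.1.2) →
          (φ'.Realize (fun k => w (E (f k))) ↔
            familyTuple B (fun k x => w (.inl (i k, x))) ∈ X) := by
        intro w hw
        rw [hφ]
        refine hφ' _ _ fun k => ?_
        change (⟨familySort I σ B (E (f k)), w (E (f k))⟩ : Elem M) = _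
        rcases f k with ⟨l, x⟩ | y
        · rfl
        · exact Sigma.ext rfl (heq_of_eq (hw y))
      have hX' : {w : ∀ i, M (familySort I σ B i) | φ'.Realize fun k => w (E (f k))} ∈ P := by
        refine ⟨range i, finite_range i, ⟨m, fun k => E (f k), φ', fun k => ?_, fun w => Iff.rfl⟩,
          N, e, he, ?_⟩
        · change Sum.elim (fun p : I × ι => p.1 ∈ range i) (fun _ : B => True) (E (f k))
          rcases f k with ⟨l, x⟩ | y
          · exact mem_range_self l
          · exact trivial
        · exact (hval _ fun y => rfl).2 ha'
      exact (hval v fun y => hvB _ (mem_range_self y)).1 (hv _ hX'))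
  exact ⟨g, fun y hy => Sigma.ext rfl (heq_of_eq (hg (.inr ⟨y, hy⟩))), fun k x => hg (.inl (k, x))⟩

/-- Given types over `B` of finite sequences of tuples that are compatible with passing to
subsequences, there is a sequence of tuples, indexed by a given small linear order, with these
types of finite subsequences. -/
theorem IsBigModel.exists_sequence (hM : IsBigModel L M κ) {ι : Type u} (hι : #ι < κ)
    {B : Set (Elem M)} (hB : #B < κ) (c : ∀ N, Fin N → ι → Elem M)
    (hc : ∀ n N (i : Fin n → Fin N), StrictMono i → ∃ g : Aut L M, g.Fixes B ∧
      ∀ k x, g.act (c n k x) = c N (i k) x)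
    (I : Type u) [LinearOrder I] (hI : #I < κ) :
    ∃ b : I → ι → Elem M, ∀ n (i : Fin n → I), StrictMono i → ∃ g : Aut L M, g.Fixes B ∧
      ∀ k x, g.act (c n k x) = b (i k) x := by
  have hs : ∀ N k x, (c N k x).1 = (c 1 0 x).1 := by
    intro N k x
    obtain ⟨g, -, hg⟩ := hc 1 N (fun _ => k) (Subsingleton.strictMono _)
    rw [← hg 0 x]
    rfl
  choose c' hc' using fun N k x => exists_elem_eq (hs N k x)
  obtain ⟨b, hb⟩ := hM.exists_sequence_of_sorted hι hB (fun x => (c 1 0 x).1) c' (by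
    intro n N i hi
    obtain ⟨g, hg, hgc⟩ := hc n N i hi
    refine ⟨g, hg, fun k x => ?_⟩
    have := hgc k x
    rw [← hc' n k x] at this
    exact eq_of_heq (Sigma.mk.inj (this.trans (hc' N (i k) x).symm)).2) I hI
  refine ⟨fun i x => ⟨_, b i x⟩, fun n i hi => ?_⟩
  obtain ⟨g, hg, hgb⟩ := hb n i hi
  refine ⟨g, hg, fun k x => ?_⟩
  rw [← hc']
  exact Sigma.ext rfl (heq_of_eq (hgb k x))

/-- Every sufficiently long sequence of tuples contains arbitrarily long finite subsequences
whose types over `B` are compatible with passing to subsequences. -/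
theorem IsBigModel.exists_wellOrder_subsequences (hM : IsBigModel L M κ) {ι : Type u}
    (hι : #ι < κ) {B : Set (Elem M)} (hB : #B < κ) :
    ∃ (I : Type u) (_ : LinearOrder I) (_ : WellFoundedLT I), #I < κ ∧
      ∀ (_ : ι → Elem M) (a : I → ι → Elem M), ∃ e : ∀ N, Fin N → I, (∀ N, StrictMono (e N)) ∧
        ∀ n N (i : Fin n → Fin N), StrictMono i → ∃ g : Aut L M, g.Fixes B ∧
          ∀ k x, g.act (a (e n k) x) = a (e N (i k)) x := by
  obtain ⟨Λ, tp, hΛ, htp⟩ := hM.exists_typeCode_over (ι := ℕ × ι) (by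
    simp only [mk_prod, mk_nat, lift_aleph0, lift_uzero]
    exact mul_lt_of_lt hM.aleph0_lt.le hM.aleph0_lt hι) hB
  obtain ⟨I, hIo, hIw, hI, hER⟩ := ErdosRado.exists_wellOrder_homogeneous hM.beth_eq hΛ
  refine ⟨I, hIo, hIw, hI, fun a₀ a => ?_⟩
  -- Padding with `a₀` gives all finite subsequences the same index set, so that their types form a
  -- single set of colours.
  let t : Finset I → ℕ × ι → Elem M := fun s p =>
    if h : p.1 < s.card then a (s.orderEmbOfFin rfl ⟨p.1, h⟩) p.2 else a₀ p.2
  obtain ⟨q, hq⟩ := hER fun s => tp (t s)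
  choose S hScard hS using hq
  have htS : ∀ n (s : Finset I) (hs : s.card = n) (k : Fin n) x,
      t s (k, x) = a (s.orderEmbOfFin hs k) x := by
    rintro n s rfl k x
    exact dif_pos k.2
  refine ⟨fun N => (S N).orderEmbOfFin (hScard N), fun N => OrderEmbedding.strictMono _,
    fun n N i hi => ?_⟩
  set s : Finset I := Finset.univ.image fun k => (S N).orderEmbOfFin (hScard N) (i k) with hs
  have hmono : StrictMono fun k => (S N).orderEmbOfFin (hScard N) (i k) :=
    (OrderEmbedding.strictMono _).comp hi
  have hscard : s.card = n := by
    rw [hs, Finset.card_image_of_injective _ hmono.injective]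
    simp
  have hsS : s ⊆ S N := fun x hx => by
    obtain ⟨k, -, rfl⟩ := Finset.mem_image.1 hx
    exact Finset.orderEmbOfFin_mem _ _ _
  have hse : (fun k => (S N).orderEmbOfFin (hScard N) (i k)) = s.orderEmbOfFin hscard :=
    Finset.orderEmbOfFin_unique hscard (fun k => Finset.mem_image_of_mem _ (Finset.mem_univ k))
      hmono
  obtain ⟨g, hg, hgt⟩ := htp (t (S n)) (t s) (by
    have h1 := hS n (S n) subset_rfl
    have h2 := hS N s hsS
    rw [h1, h2, hScard, hscard])
  refine ⟨g, hg, fun k x => ?_⟩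
  have := hgt (k, x)
  rw [htS n _ (hScard n), htS n s hscard] at this
  rw [this]
  exact congrArg (fun j => a j x) (congrFun hse k).symm

end Sequences
/-! ### Independence relations -/

section Small

variable {L : Language.{u}} {M : L.Srt → Type u} {κ : Cardinal.{u}}

theorem mk_lt_of_subset {A B : Set (Elem M)} (hB : #B < κ) (h : A ⊆ B) : #A < κ :=
  (mk_le_mk_of_subset h).trans_lt hB

theorem mk_image_lt {A : Set (Elem M)} (hA : #A < κ) (f : Elem M → Elem M) : #(f '' A) < κ :=
  mk_image_le.trans_lt hA

theorem mk_range_lt {ι : Type u} (hι : #ι < κ) (a : ι → Elem M) : #(range a) < κ :=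
  mk_range_le.trans_lt hι

theorem exists_finset_subset_biUnion {α J : Type*} {A : Set α} (hA : A.Finite) {T : Set J}
    {t : J → Set α} (h : A ⊆ ⋃ j ∈ T, t j) :
    ∃ s : Finset J, (s : Set J) ⊆ T ∧ A ⊆ ⋃ j ∈ s, t j := by
  classical
  rcases A.eq_empty_or_nonempty with rfl | ⟨x₀, hx₀⟩
  · exact ⟨∅, by simp, empty_subset _⟩
  have h' : ∀ x ∈ A, ∃ j ∈ T, x ∈ t j := fun x hx => by
    simpa using h hx
  have : Nonempty J := ⟨(h' x₀ hx₀).choose⟩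
  lift A to Finset α using hA
  choose! f hfT hft using h'
  refine ⟨A.image f, fun j hj => ?_, fun x hx => ?_⟩
  · obtain ⟨x, hx, rfl⟩ := Finset.mem_image.1 hj
    exact hfT x hx
  · exact mem_biUnion (Finset.mem_image_of_mem f hx) (hft x hx)

/-- Applied to a base provided by local character: in a long enough sequence it only involves a
proper initial segment. -/
theorem exists_subset_biUnion_lt {α J : Type u} [LinearOrder J] {μ : Cardinal.{u}}
    (hJ : ∀ S : Set J, #S < μ → ∃ i, ∀ j ∈ S, j < i) {C D : Set α} (hD : #D < μ)
    {t : J → Set α} (h : D ⊆ C ∪ ⋃ j, t j) : ∃ i, D ⊆ C ∪ ⋃ j ∈ Iio i, t j := by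
  classical
  obtain ⟨i₀, -⟩ := hJ ∅ (by
    rw [mk_eq_zero]; exact (zero_le).trans_lt hD)
  have h' : ∀ x ∈ D, ∃ j, x ∈ C ∨ x ∈ t j := fun x hx => by
    rcases h hx with hC | ht
    · exact ⟨i₀, Or.inl hC⟩
    · obtain ⟨j, hj⟩ := mem_iUnion.1 ht
      exact ⟨j, Or.inr hj⟩
  have : Nonempty J := ⟨i₀⟩
  choose! f hf using h'
  obtain ⟨i, hi⟩ := hJ (f '' D) (mk_image_le.trans_lt hD)
  refine ⟨i, fun x hx => ?_⟩
  rcases hf x hx with hC | ht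
  · exact Or.inl hC
  · exact Or.inr (mem_biUnion (hi _ (mem_image_of_mem f hx)) ht)

end Small

section Independence

variable {L : Language.{u}} {M : L.Srt → Type u} [Struct L M] {κ : Cardinal.{u}}
  {ind : Set (Elem M) → Set (Elem M) → Set (Elem M) → Prop}

theorem IsBigModel.mk_union_lt (hM : IsBigModel L M κ) {A B : Set (Elem M)} (hA : #A < κ)
    (hB : #B < κ) : #(A ∪ B : Set (Elem M)) < κ :=
  (mk_union_le A B).trans_lt (add_lt_of_lt hM.aleph0_lt.le hA hB)

theorem IsBigModel.mk_iUnion_range_lt (hM : IsBigModel L M κ) {I ι : Type u} (hI : #I < κ)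
    (hι : #ι < κ) (a : I → ι → Elem M) : #(⋃ i, range (a i)) < κ := by
  have h : (⋃ i, range (a i)) = range fun p : I × ι => a p.1 p.2 := by
    ext x
    simp [mem_iUnion]
  rw [h]
  refine mk_range_le.trans_lt ?_
  rw [mk_prod, lift_id, lift_id]
  exact mul_lt_of_lt hM.aleph0_lt.le hI hι

theorem IsBigModel.mk_iUnion_nat_range_lt (hM : IsBigModel L M κ) {ι : Type u} (hι : #ι < κ)
    (a : ℕ → ι → Elem M) : #(⋃ i, range (a i)) < κ := by
  refine mk_lt_of_subset (hM.mk_iUnion_range_lt (I := ULift.{u} ℕ)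
    (by simpa using hM.aleph0_lt) hι fun i => a i.down) (iUnion_subset fun i => ?_)
  exact subset_iUnion (fun i : ULift.{u} ℕ => range (a i.down)) ⟨i⟩

/-- Each small cardinal `μ` has a small linear order in which all sets of cardinality less
than `μ` are bounded. -/
theorem IsBigModel.exists_linearOrder_bounded (hM : IsBigModel L M κ) {μ : Cardinal.{u}}
    (hμ : μ < κ) : ∃ (J : Type u) (_ : LinearOrder J), #J < κ ∧
      ∀ S : Set J, #S < μ → ∃ i, ∀ j ∈ S, j < i := by
  set c := Order.succ (max μ ℵ₀) with hc
  have hreg : c.IsRegular := isRegular_succ (le_max_right _ _)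
  have hcκ : c < κ := hM.isStrongLimit.isSuccLimit.succ_lt (max_lt hμ hM.aleph0_lt)
  refine ⟨c.ord.ToType, inferInstance, by rwa [mk_ord_toType], fun S hS => ?_⟩
  have hncof : ¬ IsCofinal S := fun h => by
    have := Order.cof_le h
    rw [Ordinal.cof_toType, hreg.cof_ord] at this
    exact (hS.trans_le ((le_max_left _ _).trans (Order.le_succ _))).not_ge this
  simp only [IsCofinal, not_forall, not_exists, not_and, not_le] at hncof
  exact hncof

theorem IsIndependenceRelation.existence (hI : IsIndependenceRelation L κ ind)
    {A C : Set (Elem M)} (hA : #A < κ) (hC : #C < κ) :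
    ind A C C := by
  obtain ⟨μ, -, h⟩ := hI.local_character A hA
  obtain ⟨C', hC', -, hind⟩ := h C hC
  exact hI.base_monotonicity A C C C' hA hC hC' subset_rfl hind

theorem IsIndependenceRelation.of_aut (hI : IsIndependenceRelation L κ ind)
    {A B C A' B' : Set (Elem M)} (hA : #A < κ) (hB : #B < κ)
    (hC : #C < κ) (h : ind A C B) (g : Aut L M) (hg : g.Fixes C) (hA' : A' ⊆ g.act '' A)
    (hB' : B' ⊆ g.act '' B) : ind A' C B' := by
  have := hI.invariance A B C hA hB hC g h
  rw [hg.image_eq] at this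
  exact hI.monotonicity _ _ _ _ _ (mk_image_lt hA _) (mk_image_lt hB _) hC hA' hB' this

/-! ### Consequences of the axioms that precede symmetry. -/

section Basic

variable (hM : IsBigModel L M κ) (hI : IsIndependenceRelation L κ ind)
include hM hI

/-- Extension moves `A` over `B ∪ C` to a set independent from `acl (B ∪ C)`. Moving back costs
nothing, because the automorphism preserves `acl (B ∪ C)` setwise. -/
theorem IsIndependenceRelation.right_acl_union {A B C : Set (Elem M)} (hA : #A < κ) (hB : #B < κ)
    (hC : #C < κ) (h : ind A C B) : ind A C (acl L (B ∪ C)) := by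
  have hBC := hM.mk_union_lt hB hC
  obtain ⟨g, hg, hind⟩ := hI.extension A B C (acl L (B ∪ C)) hA (hM.mk_acl_lt hBC) hC h
    (subset_union_left.trans (subset_acl _))
  refine hI.of_aut (mk_image_lt hA _) (hM.mk_acl_lt hBC) hC hind g.inv
    (hg.inv.mono subset_union_right) ?_ ?_
  · rw [g.inv_image_image]
  · rw [hg.inv.image_acl]

theorem IsIndependenceRelation.right_union {A B C : Set (Elem M)} (hA : #A < κ) (hB : #B < κ)
    (hC : #C < κ) (h : ind A C B) : ind A C (B ∪ C) :=
  hI.monotonicity _ _ _ _ _ hA (hM.mk_acl_lt (hM.mk_union_lt hB hC)) hC subset_rfl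
    (subset_acl _) (hI.right_acl_union hM hA hB hC h)

theorem IsIndependenceRelation.left_empty {B C : Set (Elem M)} (hB : #B < κ) (hC : #C < κ) :
    ind ∅ C B := by
  have he : #(∅ : Set (Elem M)) < κ := by
    rw [mk_eq_zero]; exact aleph0_pos.trans hM.aleph0_lt
  obtain ⟨g, -, h⟩ := hI.extension ∅ C C (B ∪ C) he (hM.mk_union_lt hB hC) hC
    (hI.existence he hC) subset_union_right
  rw [image_empty] at h
  exact hI.monotonicity _ _ _ _ _ he (hM.mk_union_lt hB hC) hC subset_rfl subset_union_left h

theorem IsIndependenceRelation.left_union {C X Y Z : Set (Elem M)} (hC : #C < κ) (hX : #X < κ)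
    (hY : #Y < κ) (hZ : #Z < κ) (h : ind Y C X) (h' : ind Z (C ∪ Y) X) :
    ind (Z ∪ (C ∪ Y)) C X := by
  have hCY := hM.mk_union_lt hC hY
  refine hI.transitivity X (Z ∪ (C ∪ Y)) (C ∪ Y) C hX (hM.mk_union_lt hZ hCY)
    subset_union_left subset_union_right (hI.normality _ _ _ hZ hX hCY h') ?_
  rw [union_comm C Y]
  exact hI.normality _ _ _ hY hX hC h

/-- The tuples are added in increasing order. Since `E m` contains the base, `X` and the earlier
tuples, base monotonicity moves the earlier tuples into the base, and `left_union` brings them back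
to the left. -/
theorem IsIndependenceRelation.left_biUnion {J : Type*} [LinearOrder J] {ι : Type u}
    (hι : #ι < κ) {a : J → ι → Elem M} {C X : Set (Elem M)} (hC : #C < κ) (hX : #X < κ)
    {E : J → Set (Elem M)} (hE : ∀ i, #(E i) < κ) (s : Finset J)
    (hind : ∀ i ∈ s, ind (range (a i)) C (E i)) (hCE : ∀ i ∈ s, C ⊆ E i)
    (hXE : ∀ i ∈ s, X ⊆ E i) (haE : ∀ i ∈ s, ∀ j ∈ s, j < i → range (a j) ⊆ E i) :
    ind (⋃ j ∈ s, range (a j)) C X := by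
  classical
  induction s using Finset.induction_on_max with
  | empty => simpa using hI.left_empty hM hX hC
  | insert m s hm ih =>
    have hY := ih (fun i hi => hind i (Finset.mem_insert_of_mem hi))
      (fun i hi => hCE i (Finset.mem_insert_of_mem hi))
      (fun i hi => hXE i (Finset.mem_insert_of_mem hi))
      (fun i hi j hj => haE i (Finset.mem_insert_of_mem hi) j (Finset.mem_insert_of_mem hj))
    have hms : m ∈ insert m s := Finset.mem_insert_self m s
    have hYE : (⋃ j ∈ s, range (a j)) ⊆ E m := iUnion₂_subset fun j hj =>
      haE m hms j (Finset.mem_insert_of_mem hj) (hm j hj)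
    have hYs : #(⋃ j ∈ s, range (a j) : Set (Elem M)) < κ := mk_lt_of_subset (hE m) hYE
    have hZ := mk_range_lt hι (a m)
    have hCY := hM.mk_union_lt hC hYs
    have h2 := hI.monotonicity _ _ _ _ X hZ (hE m) hCY subset_rfl (hXE m hms)
      (hI.base_monotonicity _ _ (C ∪ ⋃ j ∈ s, range (a j)) C hZ (hE m) subset_union_left
        (union_subset (hCE m hms) hYE) (hind m hms))
    refine hI.monotonicity _ _ _ _ _ (hM.mk_union_lt hZ hCY) hX hC ?_ subset_rfl
      (hI.left_union hM hC hX hYs hZ hY h2)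
    rw [Finset.set_biUnion_insert]
    exact union_subset_union_right _ subset_union_right

theorem IsIndependenceRelation.exists_long_sequence {ι : Type u} (hι : #ι < κ)
    (a₀ : ι → Elem M) {B C : Set (Elem M)} (hB : #B < κ) (hCB : C ⊆ B)
    (h : ind (range a₀) C B) (I : Type u) [LinearOrder I] [WellFoundedLT I] (hIκ : #I < κ) :
    ∃ a : I → ι → Elem M, (∀ i, EquivOver L B a₀ (a i)) ∧
      ∀ i, ind (range (a i)) C (B ∪ ⋃ j ∈ Iio i, range (a j)) := by
  have hC := mk_lt_of_subset hB hCB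
  -- Smallness of `E` is a premise inside the existential so that `G` is total: the recursion
  -- defining `g` runs before its earlier values are known to span a small set.
  have hext : ∀ E : Set (Elem M), ∃ g : Aut L M, #E < κ → g.Fixes B ∧
      ind (range fun x => g.act (a₀ x)) C (B ∪ E) := by
    intro E
    by_cases hE : #E < κ
    · obtain ⟨g, hg, hind⟩ := hI.extension _ B C (B ∪ E) (mk_range_lt hι a₀)
        (hM.mk_union_lt hB hE) hC h subset_union_left
      rw [← range_comp] at hind
      exact ⟨g, fun _ => ⟨hg.mono subset_union_left, hind⟩⟩
    · exact ⟨Aut.id L M, fun h => absurd h hE⟩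
  choose G hG using hext
  let g : I → Aut L M := (wellFounded_lt (α := I)).fix fun i rec =>
    G (⋃ (j) (hj : j < i), range fun x => (rec j hj).act (a₀ x))
  have hg : ∀ i, g i = G (⋃ (j) (_ : j < i), range fun x => (g j).act (a₀ x)) := fun i =>
    (wellFounded_lt (α := I)).fix_eq _ i
  have hsmall : ∀ i, #(⋃ (j) (_ : j < i), range fun x => (g j).act (a₀ x) : Set (Elem M)) < κ :=
    fun i => mk_lt_of_subset (hM.mk_iUnion_range_lt (by simpa using hIκ) hι fun j x =>
      (g j).act (a₀ x)) (iUnion_mono fun j => iUnion_subset fun _ => subset_rfl)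
  refine ⟨fun i x => (g i).act (a₀ x), fun i => ⟨g i, ?_, fun x => rfl⟩, fun i => ?_⟩
  · rw [hg]; exact (hG _ (hsmall i)).1
  · have := (hG _ (hsmall i)).2
    rw [← hg] at this
    exact this

end Basic
end Independence
/-! ### Symmetry and Morley sequences -/

section Symmetry

variable {L : Language.{u}} {M : L.Srt → Type u} [Struct L M] {κ : Cardinal.{u}}
  {ind : Set (Elem M) → Set (Elem M) → Set (Elem M) → Prop}

theorem image_range {ι : Type*} {g : Aut L M} {a b : ι → Elem M}
    (h : ∀ x, g.act (a x) = b x) : g.act '' range a = range b := by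
  rw [← range_comp]
  exact congrArg range (funext h)

theorem EquivOver.symm {ι : Type u} {B : Set (Elem M)} {a b : ι → Elem M}
    (h : EquivOver L B a b) : EquivOver L B b a := by
  obtain ⟨g, hg, hgab⟩ := h
  exact ⟨g.inv, hg.inv, fun x => by rw [← hgab, g.inv_act_act]⟩

theorem EquivOver.trans {ι : Type u} {B : Set (Elem M)} {a b c : ι → Elem M}
    (h : EquivOver L B a b) (h' : EquivOver L B b c) : EquivOver L B a c := by
  obtain ⟨g, hg, hgab⟩ := h
  obtain ⟨g', hg', hgbc⟩ := h'
  exact ⟨g'.comp g, hg'.comp hg, fun x => by rw [Aut.comp_act, hgab, hgbc]⟩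

theorem IsIndependenceRelation.of_equivOver (hI : IsIndependenceRelation L κ ind) {ι : Type u}
    (hι : #ι < κ) {a b : ι → Elem M} {B C : Set (Elem M)} (hB : #B < κ) (hC : #C < κ)
    (h : EquivOver L (B ∪ C) a b) (hind : ind (range a) C B) : ind (range b) C B := by
  obtain ⟨g, hg, hgab⟩ := h
  refine hI.of_aut (mk_range_lt hι a) hB hC hind g (hg.mono subset_union_right) ?_ ?_
  · rw [image_range hgab]
  · rw [(hg.mono subset_union_left).image_eq]

variable (hM : IsBigModel L M κ) (hI : IsIndependenceRelation L κ ind)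
include hM hI

/-- Choose a long sequence of conjugates of `A` over `B ∪ C`, each independent over `C` from `B` and
the earlier ones. Its later terms are jointly independent from an earlier one, so reversing the
order produces a sequence `b'` with `b'_{<i} ⊥_C b'_i`. If `b'` is long, local character of `B`
gives some `i` with `B ⊥_{C b'_{<i}} b'_i`. Transitivity yields `B ⊥_C b'_i`, and `b'_i` is
conjugate to `A` over `B ∪ C`. -/
theorem IsIndependenceRelation.symm {A B C : Set (Elem M)} (hA : #A < κ) (hB : #B < κ)
    (hC : #C < κ) (h : ind A C B) : ind B C A := by
  have hBC := hM.mk_union_lt hB hC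
  let a₀ : A → Elem M := Subtype.val
  have ha₀ : range a₀ = A := Subtype.range_val
  obtain ⟨I, _, _, hIκ, hsub⟩ := hM.exists_wellOrder_subsequences (ι := A) hA hBC
  obtain ⟨a, haeq, haind⟩ := hI.exists_long_sequence hM hA a₀ hBC subset_union_right
    (ha₀.symm ▸ hI.right_union hM hA hB hC h) I hIκ
  obtain ⟨e, he, hge⟩ := hsub a₀ a
  have htail : ∀ (s : Finset I) (i : I), (∀ j ∈ s, i < j) →
      ind (⋃ j ∈ s, range (a j)) C (range (a i)) := by
    intro s i hs
    have hsmall : ∀ i, #(B ∪ C ∪ ⋃ j ∈ Iio i, range (a j) : Set (Elem M)) < κ := fun i =>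
      hM.mk_union_lt hBC (mk_lt_of_subset (hM.mk_iUnion_range_lt hIκ hA a)
        (iUnion_mono fun j => iUnion_subset fun _ => subset_rfl))
    refine hI.left_biUnion hM hA hC (mk_range_lt hA _) hsmall s (fun j _ => haind j)
      (fun j _ => subset_union_right.trans subset_union_left) (fun j hj => ?_)
      fun j _ k _ hkj => ?_
    · exact (subset_biUnion_of_mem (s := Iio j) (u := fun j => range (a j)) (hs j hj)).trans
        subset_union_right
    · exact (subset_biUnion_of_mem (s := Iio j) (u := fun j => range (a j)) hkj).trans subset_union_right
  obtain ⟨μ, hμ, hloc⟩ := hI.local_character B hB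
  obtain ⟨J, _, hJ, hbdd⟩ := hM.exists_linearOrder_bounded hμ
  -- The dual order is used because `htail` has the later terms on the left, while boundedness in
  -- `J` captures earlier ones.
  obtain ⟨b, hb⟩ := hM.exists_sequence hA hBC (fun N k => a (e N k)) hge Jᵒᵈ hJ
  let b' : J → A → Elem M := fun j => b (OrderDual.toDual j)
  have hfin : ∀ (s : Finset J) (i : J), (∀ j ∈ s, j < i) →
      ind (⋃ j ∈ s, range (b' j)) C (range (b' i)) := by
    intro s i hs
    let S : Finset Jᵒᵈ := (insert i s).map OrderDual.toDual.toEmbedding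
    have hS : ∀ j ∈ insert i s, ∃ k, S.orderEmbOfFin rfl k = OrderDual.toDual j := by
      intro j hj
      have : OrderDual.toDual j ∈ range (S.orderEmbOfFin rfl) := by
        rw [Finset.range_orderEmbOfFin]
        exact Finset.mem_coe.2 (Finset.mem_map_of_mem _ hj)
      exact this
    obtain ⟨g, hg, hgb⟩ := hb _ (S.orderEmbOfFin rfl) (OrderEmbedding.strictMono _)
    obtain ⟨k, hk⟩ := hS i (Finset.mem_insert_self _ _)
    have h1 := htail ((Finset.univ.filter (k < ·)).image (e S.card)) (e S.card k) (by
      intro j hj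
      obtain ⟨l, hl, rfl⟩ := Finset.mem_image.1 hj
      exact he _ (Finset.mem_filter.1 hl).2)
    refine hI.of_aut (mk_lt_of_subset (hM.mk_iUnion_range_lt hIκ hA a)
        (iUnion_mono fun j => iUnion_subset fun _ => subset_rfl)) (mk_range_lt hA _) hC h1 g
      (hg.mono subset_union_right) ?_ ?_
    · refine iUnion₂_subset fun j hj => ?_
      obtain ⟨l, hl⟩ := hS j (Finset.mem_insert_of_mem hj)
      rintro _ ⟨x, rfl⟩
      refine ⟨a (e _ l) x, mem_biUnion (Finset.mem_image_of_mem _ (Finset.mem_filter.2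
        ⟨Finset.mem_univ _, ?_⟩)) (mem_range_self x), ?_⟩
      · rw [← (S.orderEmbOfFin rfl).lt_iff_lt, hk, hl]
        exact OrderDual.toDual_lt_toDual.2 (hs j hj)
      · rw [hgb, hl]
    · rintro _ ⟨x, rfl⟩
      exact ⟨_, mem_range_self x, by rw [hgb, hk]⟩
  have hbsmall := hM.mk_iUnion_range_lt hJ hA b'
  have hbsmall' : ∀ i, #(⋃ j ∈ Iio i, range (b' j) : Set (Elem M)) < κ := fun i =>
    mk_lt_of_subset hbsmall (iUnion_mono fun j => iUnion_subset fun _ => subset_rfl)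
  have hlt : ∀ i, ind (⋃ j ∈ Iio i, range (b' j)) C (range (b' i)) := by
    intro i
    refine hI.finite_character _ _ _ (hbsmall' i) (mk_range_lt hA _) hC fun A₀ hA₀ hfinA₀ => ?_
    obtain ⟨s, hs, hAs⟩ := exists_finset_subset_biUnion hfinA₀ hA₀
    exact hI.monotonicity _ _ _ _ _ (mk_lt_of_subset hbsmall
      (iUnion_mono fun j => iUnion_subset fun _ => subset_rfl)) (mk_range_lt hA _) hC hAs
      subset_rfl (hfin s i hs)
  have hU := hM.mk_union_lt hC hbsmall
  obtain ⟨D, hDU, hDμ, hDind⟩ := hloc _ hU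
  obtain ⟨i, hDi⟩ := exists_subset_biUnion_lt hbdd hDμ hDU
  have hVU : C ∪ (⋃ j ∈ Iio i, range (b' j)) ⊆ C ∪ ⋃ j, range (b' j) :=
    union_subset_union_right _ (iUnion_mono fun j => iUnion_subset fun _ => subset_rfl)
  have h1 : ind B (C ∪ ⋃ j ∈ Iio i, range (b' j)) (range (b' i)) :=
    hI.monotonicity _ _ _ _ _ hB hU (mk_lt_of_subset hU hVU) subset_rfl
      ((subset_iUnion (fun j => range (b' j)) i).trans subset_union_right)
      (hI.base_monotonicity _ _ _ _ hB hU hDi hVU hDind)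
  have h2 := hI.left_union hM hC (mk_range_lt hA _) (hbsmall' i) hB (hlt i) h1
  have heq : EquivOver L (B ∪ C) a₀ (b' i) := by
    obtain ⟨g, hg, hgb⟩ := hb 1 (fun _ => OrderDual.toDual i) (Subsingleton.strictMono _)
    exact (haeq (e 1 0)).trans ⟨g, hg, hgb 0⟩
  obtain ⟨g, hg, hga⟩ := heq.symm
  refine hI.of_aut (hM.mk_union_lt hB (hM.mk_union_lt hC (hbsmall' i))) (mk_range_lt hA _) hC h2 g
    (hg.mono subset_union_right) ?_ ?_
  · have := (hg.mono subset_union_left).image_eq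
    exact this.symm.subset.trans (image_mono subset_union_left)
  · rw [image_range hga, ha₀]

theorem IsIndependenceRelation.acl_union {A B C : Set (Elem M)} (hA : #A < κ) (hB : #B < κ)
    (hC : #C < κ) (h : ind A C B) : ind (acl L (A ∪ C)) C (acl L (B ∪ C)) := by
  have hBC := hM.mk_acl_lt (hM.mk_union_lt hB hC)
  have hAC := hM.mk_acl_lt (hM.mk_union_lt hA hC)
  exact hI.symm hM hBC hAC hC (hI.right_acl_union hM hBC hA hC
    (hI.symm hM hA hBC hC (hI.right_acl_union hM hA hB hC h)))

/-- Existence over `B` starts a long independent sequence, from which an indiscernible one of order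
type `ω` is extracted. Symmetry puts the earlier terms on the left. -/
theorem IsIndependenceRelation.exists_isMorleySequenceFor {ι : Type u} (hι : #ι < κ)
    (a₀ : ι → Elem M) {B : Set (Elem M)} (hB : #B < κ) :
    ∃ a : ℕ → ι → Elem M, IsMorleySequenceFor L ind a₀ B a := by
  obtain ⟨I, _, _, hIκ, hsub⟩ := hM.exists_wellOrder_subsequences hι hB
  obtain ⟨a, haeq, haind⟩ := hI.exists_long_sequence hM hι a₀ hB subset_rfl
    (hI.existence (mk_range_lt hι a₀) hB) I hIκ
  obtain ⟨e, he, hge⟩ := hsub a₀ a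
  obtain ⟨b, hb⟩ := hM.exists_sequence hι hB (fun N k => a (e N k)) hge (ULift.{u} ℕ)
    (by simpa using hM.aleph0_lt)
  have hb' : ∀ n (i : Fin n → ℕ), StrictMono i → ∃ g : Aut L M, g.Fixes B ∧
      ∀ k x, g.act (a (e n k) x) = b ⟨i k⟩ x := fun n i hi =>
    hb n (fun k => ⟨i k⟩) fun _ _ hkl => hi hkl
  refine ⟨fun n => b ⟨n⟩, subset_rfl, fun n i j hi hj => ?_, fun n => ?_, fun n => ?_⟩
  · obtain ⟨g, hg, hgb⟩ := hb' n i hi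
    obtain ⟨g', hg', hgb'⟩ := hb' n j hj
    exact ⟨g'.comp g.inv, hg'.comp hg.inv, fun k x => by
      rw [← hgb, Aut.comp_act, g.inv_act_act, hgb']⟩
  · obtain ⟨g, hg, hgb⟩ := hb' 1 (fun _ => n) (Subsingleton.strictMono _)
    exact (haeq (e 1 0)).trans ⟨g, hg, hgb 0⟩
  · obtain ⟨g, hg, hgb⟩ := hb' (n + 1) Fin.val Fin.val_strictMono
    have hsmall : #(⋃ j ∈ Iio (e (n + 1) (Fin.last n)), range (a j) : Set (Elem M)) < κ :=
      mk_lt_of_subset (hM.mk_iUnion_range_lt hIκ hι a)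
        (iUnion_mono fun j => iUnion_subset fun _ => subset_rfl)
    have h1 := hI.symm hM (mk_range_lt hι _) (hM.mk_union_lt hB hsmall) hB
      (haind (e (n + 1) (Fin.last n)))
    refine hI.of_aut (hM.mk_union_lt hB hsmall) (mk_range_lt hι _) hB h1 g hg ?_ ?_
    · refine iUnion₂_subset fun j hj => ?_
      rintro _ ⟨x, rfl⟩
      have hj' : j < n := hj
      refine ⟨a (e (n + 1) ⟨j, by omega⟩) x, Or.inr (mem_biUnion (he _ ?_) (mem_range_self x)), ?_⟩
      · exact Fin.mk_lt_mk.2 hj'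
      · rw [hgb]
    · rintro _ ⟨x, rfl⟩
      exact ⟨_, mem_range_self x, hgb (Fin.last n) x⟩

end Symmetry

/-! ### Weak canonical bases -/

section WeakCanonicalBases

variable {L : Language.{u}} {M : L.Srt → Type u} [Struct L M] {κ : Cardinal.{u}}
  {ind : Set (Elem M) → Set (Elem M) → Set (Elem M) → Prop} (hM : IsBigModel L M κ)
include hM

theorem IsStrictIndependenceRelation.aker_subset (hI : IsStrictIndependenceRelation L κ ind)
    {ι : Type u} (hι : #ι < κ) {a₀ : ι → Elem M} {B D : Set (Elem M)} (hB : #B < κ)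
    {a : ℕ → ι → Elem M} (ha : IsMorleySequenceFor L ind a₀ B a) (hD : acl L D = D) (hDB : D ⊆ B)
    (hind : ind (range a₀) D B) : aker L a ⊆ D := by
  have hI' := hI.toIsIndependenceRelation
  have hDs := mk_lt_of_subset hB hDB
  have hr : ∀ n, #(range (a n)) < κ := fun n => mk_range_lt hι (a n)
  have hsm : ∀ T : Set ℕ, #(⋃ j ∈ T, range (a j) : Set (Elem M)) < κ := fun T =>
    mk_lt_of_subset (hM.mk_iUnion_nat_range_lt hι a)
      (iUnion_mono fun j => iUnion_subset fun _ => subset_rfl)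
  -- The independence over `B` from the Morley sequence and `a n ⊥_D B` are composed by
  -- transitivity, with symmetry exchanging the sides.
  have hstep : ∀ n, ind (range (a n)) D (B ∪ ⋃ j ∈ Iio n, range (a j)) := by
    intro n
    have h1 : ind (range (a n)) D B := hI'.of_equivOver hι hB hDs
      (by rw [union_eq_self_of_subset_right hDB]; exact ha.realises n) hind
    have h2 := hI'.normality _ _ _ (hsm _) (hr n) hB (ha.independent n)
    rw [union_comm B]
    exact hI'.symm hM (hM.mk_union_lt (hsm _) hB) (hr n) hDs
      (hI'.transitivity _ _ _ _ (hr n) (hM.mk_union_lt (hsm _) hB) hDB subset_union_right h2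
        (hI'.symm hM (hr n) hB hDs h1))
  rintro d ⟨hdacl, hdind⟩
  obtain ⟨A₀, hA₀, hfin, hdA₀⟩ := exists_finite_mem_acl hdacl
  obtain ⟨s, -, hs⟩ := exists_finset_subset_biUnion (T := Set.univ) hfin (by simpa using hA₀)
  obtain ⟨n, hn⟩ := s.exists_nat_subset_range
  have hd1 : d ∈ acl L (⋃ j ∈ Finset.range n, range (a j)) :=
    acl_mono (hs.trans (biUnion_mono hn fun _ _ => subset_rfl)) hdA₀
  -- Shifting by `n` carries the block `[0, n)` to the disjoint block `[n, 2n)` while fixing `d`.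
  obtain ⟨g, hg, hga⟩ := hdind n (fun k => k) (fun k => n + k) (fun _ _ h => h)
    fun _ _ h => Nat.add_lt_add_left h n
  have hd2 : d ∈ acl L (⋃ j ∈ Finset.Ico n (n + n), range (a j)) := by
    have := act_mem_acl g hd1
    rw [hg d rfl] at this
    refine acl_mono ?_ this
    rintro _ ⟨y, hy, rfl⟩
    obtain ⟨j, hj, x, rfl⟩ := mem_iUnion₂.1 hy
    have hj' := Finset.mem_range.1 hj
    rw [hga ⟨j, hj'⟩ x]
    exact mem_biUnion (Finset.mem_coe.2 (Finset.mem_Ico.2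
      ⟨Nat.le_add_right _ _, Nat.add_lt_add_left hj' n⟩)) (mem_range_self x)
  have hX := hsm (Finset.range n)
  have hY := hsm (Finset.Ico n (n + n))
  have h1 := hI'.left_biUnion hM hι hDs hX (fun i => hM.mk_union_lt hB (hsm (Iio i)))
    (Finset.Ico n (n + n)) (fun i _ => hstep i) (fun i _ => hDB.trans subset_union_left)
    (fun i hi => (iUnion₂_subset fun j hj => subset_biUnion_of_mem (s := Iio i) (u := fun j => range (a j))
      (Finset.mem_range.1 (Finset.mem_coe.1 hj) |>.trans_le (Finset.mem_Ico.1 hi).1)).trans subset_union_right)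
    (fun i _ j _ hji => (subset_biUnion_of_mem (s := Iio i) (u := fun j => range (a j)) hji).trans
      subset_union_right)
  have h2 := hI'.acl_union hM hY hX hDs h1
  have h3 : ind {d} D {d} := hI'.monotonicity _ _ _ _ _ (hM.mk_acl_lt (hM.mk_union_lt hY hDs))
    (hM.mk_acl_lt (hM.mk_union_lt hX hDs)) hDs
    (singleton_subset_iff.2 (acl_mono subset_union_left hd2))
    (singleton_subset_iff.2 (acl_mono subset_union_left hd1)) h2
  rw [← hD]
  exact hI.anti_reflexivity d D hDs h3

theorem IsCanonicalIndependenceRelation.exists_subset_aker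
    (hI : IsCanonicalIndependenceRelation L κ ind) {ι : Type u} (hι : #ι < κ)
    {a₀ : ι → Elem M} {B : Set (Elem M)} (hB : #B < κ) (hBacl : acl L B = B)
    {a : ℕ → ι → Elem M} (ha : IsMorleySequenceFor L ind a₀ B a) :
    ∃ D, acl L D = D ∧ D ⊆ B ∧ ind (range a₀) D B ∧ D ⊆ aker L a := by
  have hI' := hI.toIsIndependenceRelation
  -- Local character is applied to `B`, not to the tuple: it then bounds how much of the stretched
  -- sequence is needed as a base for `B`.
  obtain ⟨μ, hμ, hloc⟩ := hI'.local_character B hB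
  obtain ⟨J, _, hJ, hbdd⟩ := hM.exists_linearOrder_bounded hμ
  obtain ⟨b, hb⟩ := hM.exists_sequence hι hB (fun N k => a k)
    (fun n N i hi => ha.indiscernible n Fin.val (fun k => i k) Fin.val_strictMono
      fun _ _ h => hi h) J hJ
  have hr : ∀ i, #(range (b i)) < κ := fun i => mk_range_lt hι (b i)
  have hbs := hM.mk_iUnion_range_lt hJ hι b
  have hbs' : ∀ T : Set J, #(⋃ j ∈ T, range (b j) : Set (Elem M)) < κ := fun T =>
    mk_lt_of_subset hbs (iUnion_mono fun j => iUnion_subset fun _ => subset_rfl)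
  have hembed : ∀ s : Finset J, ∃ (n : ℕ) (i : Fin n → J) (g : Aut L M), StrictMono i ∧
      range i = s ∧ g.Fixes B ∧ ∀ (k : Fin n) x, g.act (a k x) = b (i k) x := by
    intro s
    obtain ⟨g, hg, hgb⟩ := hb _ (s.orderEmbOfFin rfl) (OrderEmbedding.strictMono _)
    exact ⟨_, _, g, OrderEmbedding.strictMono _, Finset.range_orderEmbOfFin s rfl, hg, hgb⟩
  have hlt : ∀ i, ind (⋃ j ∈ Iio i, range (b j)) B (range (b i)) := by
    classical
    intro i
    refine hI'.finite_character _ _ _ (hbs' _) (hr i) hB fun A₀ hA₀ hfinA₀ => ?_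
    obtain ⟨s, hs, hAs⟩ := exists_finset_subset_biUnion hfinA₀ hA₀
    obtain ⟨n, f, g, hf, hfr, hg, hgb⟩ := hembed (insert i s)
    have hmem : ∀ j ∈ insert i s, ∃ k, f k = j := fun j hj => by
      have : j ∈ range f := by rw [hfr]; exact hj
      exact this
    obtain ⟨k, hk⟩ := hmem i (Finset.mem_insert_self _ _)
    refine hI'.of_aut (mk_lt_of_subset (hM.mk_iUnion_nat_range_lt hι a)
      (iUnion_mono fun j => iUnion_subset fun _ => subset_rfl)) (mk_range_lt hι _) hB
      (ha.independent k) g hg ?_ ?_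
    · refine hAs.trans (iUnion₂_subset fun j hj => ?_)
      obtain ⟨l, hl⟩ := hmem j (Finset.mem_insert_of_mem hj)
      rintro _ ⟨x, rfl⟩
      refine ⟨a l x, mem_biUnion (show (l : ℕ) < k from ?_) (mem_range_self x), ?_⟩
      · have : f l < f k := by rw [hl, hk]; exact hs hj
        exact hf.lt_iff_lt.1 this
      · rw [hgb, hl]
    · rintro _ ⟨x, rfl⟩
      exact ⟨_, mem_range_self x, by rw [hgb, hk]⟩
  obtain ⟨D, hDU, hDμ, hDind⟩ := hloc _ hbs
  obtain ⟨i, hDi⟩ := exists_subset_biUnion_lt (C := ∅) hbdd hDμ (by rwa [empty_union])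
  rw [empty_union] at hDi
  set V : Set (Elem M) := ⋃ j ∈ Iio i, range (b j) with hV
  have hVs : #V < κ := hbs' _
  have hBV := hM.mk_union_lt hB hVs
  have hVU : V ⊆ ⋃ j, range (b j) := iUnion_mono fun j => iUnion_subset fun _ => subset_rfl
  have h1 : ind B V (range (b i)) := hI'.monotonicity _ _ _ _ _ hB hbs hVs subset_rfl
    (subset_iUnion (fun j => range (b j)) i) (hI'.base_monotonicity _ _ _ _ hB hbs hDi hVU hDind)
  have h2 : ind (range (b i)) V (B ∪ V) :=
    hI'.right_union hM (hr i) hB hVs (hI'.symm hM hB (hr i) hVs h1)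
  have h3 : ind (range (b i)) B (B ∪ V) := by
    rw [union_comm]
    exact hI'.right_union hM (hr i) hVs hB (hI'.symm hM hVs (hr i) hB (hlt i))
  -- The term `b i` is independent from `B ∪ V` over each of `B` and `V`; this is the only use of
  -- the intersection property.
  have h4 := hI.intersection _ _ _ _ (hr i) hBV subset_union_left subset_union_right h3 h2
  rw [hBacl] at h4
  have hKs : #(B ∩ acl L V : Set (Elem M)) < κ := mk_lt_of_subset hB inter_subset_left
  refine ⟨B ∩ acl L V, Subset.antisymm (subset_inter ?_ ?_) (subset_acl _), inter_subset_left,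
    ?_, ?_⟩
  · exact (acl_mono inter_subset_left).trans hBacl.subset
  · exact (acl_mono inter_subset_right).trans (hM.acl_acl hVs).subset
  · have h5 := hI'.monotonicity _ _ _ _ _ (hr i) hBV hKs subset_rfl subset_union_left h4
    refine hI'.of_equivOver hι hB hKs ?_ h5
    rw [union_eq_self_of_subset_right inter_subset_left]
    obtain ⟨g, hg, hgb⟩ := hb 1 (fun _ => i) (Subsingleton.strictMono _)
    exact ((ha.realises 0).trans ⟨g, hg, hgb 0⟩).symm
  · rintro d ⟨hdB, hdV⟩
    refine ⟨?_, fun n k l hk hl => ?_⟩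
    -- Finitely many terms of `b` suffice, and an automorphism fixing `B`, hence `d`, carries them
    -- back into the original sequence.
    · obtain ⟨A₀, hA₀, hfin, hdA₀⟩ := exists_finite_mem_acl hdV
      obtain ⟨s, -, hs⟩ := exists_finset_subset_biUnion hfin hA₀
      obtain ⟨n, f, g, hf, hfr, hg, hgb⟩ := hembed s
      have := act_mem_acl g.inv hdA₀
      rw [hg.inv d hdB] at this
      refine acl_mono ?_ this
      rintro _ ⟨y, hy, rfl⟩
      obtain ⟨j, hj, x, rfl⟩ := mem_iUnion₂.1 (hs hy)
      obtain ⟨k, rfl⟩ : j ∈ range f := by rw [hfr]; exact hj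
      rw [← hgb, g.inv_act_act]
      exact mem_iUnion.2 ⟨k, mem_range_self x⟩
    · obtain ⟨g, hg, hga⟩ := ha.indiscernible n k l hk hl
      exact ⟨g, hg.mono (singleton_subset_iff.2 hdB), hga⟩

theorem IsCanonicalIndependenceRelation.isWeakCanonicalBase_aker
    (hI : IsCanonicalIndependenceRelation L κ ind) {ι : Type u} (hι : #ι < κ)
    {a₀ : ι → Elem M} {B : Set (Elem M)} (hB : #B < κ) (hBacl : acl L B = B)
    {a : ℕ → ι → Elem M} (ha : IsMorleySequenceFor L ind a₀ B a) :
    IsWeakCanonicalBase L ind a₀ B (aker L a) := by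
  have hlow : ∀ D, acl L D = D → D ⊆ B → ind (range a₀) D B → aker L a ⊆ D := fun D h1 h2 h3 =>
    hI.toIsStrictIndependenceRelation.aker_subset hM hι hB ha h1 h2 h3
  obtain ⟨D, h1, h2, h3, h4⟩ := hI.exists_subset_aker hM hι hB hBacl ha
  have hD : aker L a = D := (hlow D h1 h2 h3).antisymm h4
  exact ⟨hD ▸ ⟨h1, h2, h3⟩, fun E hE => hlow E hE.1 hE.2.1 hE.2.2⟩

theorem IsStrictIndependenceRelation.isCanonicalIndependenceRelation
    (hI : IsStrictIndependenceRelation L κ ind) (hW : HasWeakCanonicalBases L κ ind) :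
    IsCanonicalIndependenceRelation L κ ind where
  toIsStrictIndependenceRelation := hI
  intersection := by
    intro A B C₁ C₂ hA hB hC₁ hC₂ h₁ h₂
    have hI' := hI.toIsIndependenceRelation
    have hBs := hM.mk_acl_lt hB
    -- Weak canonical bases refer to algebraically closed sets only, so both base and right-hand
    -- side have to be closed up.
    have key : ∀ C, C ⊆ B → ind A C B → ind A (acl L C) (acl L B) := by
      intro C hC h
      have := hI'.right_acl_union hM hA hB (mk_lt_of_subset hB hC) h
      rw [union_eq_self_of_subset_right hC] at this
      exact hI'.base_monotonicity _ _ _ _ hA hBs (subset_acl C) (acl_mono hC) this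
    obtain ⟨C, ⟨-, hCB, hCind⟩, hCmin⟩ := hW A Subtype.val (acl L B) hA hBs (hM.acl_acl hB)
    rw [Subtype.range_val] at hCind
    have hC : ∀ C', C' ⊆ B → ind A C' B → C ⊆ acl L C' := fun C' hC' h =>
      hCmin ⟨hM.acl_acl (mk_lt_of_subset hB hC'), acl_mono hC', by
        rw [Subtype.range_val]; exact key C' hC' h⟩
    have hsub : acl L C₁ ∩ acl L C₂ ⊆ acl L B := inter_subset_left.trans (acl_mono hC₁)
    exact hI'.monotonicity _ _ _ _ _ hA hBs (mk_lt_of_subset hBs hsub) subset_rfl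
      (subset_acl B) (hI'.base_monotonicity _ _ _ _ hA hBs
        (subset_inter (hC C₁ hC₁ h₁) (hC C₂ hC₂ h₂)) hsub hCind)

end WeakCanonicalBases

end ManySorted

theorem mainTheorem10 (L : ManySorted.Language.{u}) (M : L.Srt → Type u)
    [ManySorted.Struct L M] (κ : Cardinal.{u}) (hM : ManySorted.IsBigModel L M κ)
    (ind : Set (ManySorted.Elem M) → Set (ManySorted.Elem M) → Set (ManySorted.Elem M) → Prop) :
    (ManySorted.IsStrictIndependenceRelation L κ ind →
      (ManySorted.HasWeakCanonicalBases L κ ind ↔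
        ManySorted.IsCanonicalIndependenceRelation L κ ind)) ∧
    (ManySorted.IsCanonicalIndependenceRelation L κ ind →
      ∀ (ι : Type u) (a₀ : ι → ManySorted.Elem M) (B : Set (ManySorted.Elem M)),
        #ι < κ → #B < κ → ManySorted.acl L B = B →
        (∃ a : ℕ → ι → ManySorted.Elem M, ManySorted.IsMorleySequenceFor L ind a₀ B a) ∧
        ∀ a : ℕ → ι → ManySorted.Elem M, ManySorted.IsMorleySequenceFor L ind a₀ B a →
          ManySorted.IsWeakCanonicalBase L ind a₀ B (ManySorted.aker L a)) := by
  refine ⟨fun hI => ⟨fun hW => hI.isCanonicalIndependenceRelation hM hW,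
    fun hC ι a₀ B hι hB hBacl => ?_⟩, fun hC ι a₀ B hι hB hBacl => ⟨?_, fun a ha => ?_⟩⟩
  · obtain ⟨a, ha⟩ := hI.toIsIndependenceRelation.exists_isMorleySequenceFor hM hι a₀ hB
    exact ⟨_, hC.isWeakCanonicalBase_aker hM hι hB hBacl ha⟩
  · exact hC.toIsIndependenceRelation.exists_isMorleySequenceFor hM hι a₀ hB
  · exact hC.isWeakCanonicalBase_aker hM hι hB hBacl ha
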